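/- Let $n\ge 1$ be an integer, let $s\in(0,1]$ with $s<n$, and put $p=n/s$. For $u:\mathbb{R}^n\to\mathbb{R}$ in $L^p_{\rm loc}(\mathbb{R}^n)$ set $$[u]_{W^{s,p}}=\Big(s(1-s)\iint_{\mathbb{R}^n\times\mathbb{R}^n}\frac{|u(x)-u(y)|^p}{|x-y|^{n+sp}}\,dx\,dy\Big)^{1/p}\quad(0<s<1),\qquad [u]_{W^{1,p}}=\|\nabla u\|_{L^p(\mathbb{R}^n)}\quad(s=1),$$ where $\nabla u$ is the weak gradient (and $[u]_{W^{1,p}}=+\infty$ if $u$ has no weak gradient). Let $\mathcal{D}^{s,p}(\mathbb{R}^n)$ be the completion of $C_c^\infty(\mathbb{R}^n)$ with respect to $[\,\cdot\,]_{W^{s,p}}$. Let $$\mathcal{L}^{p,n}(\mathbb{R}^n)=\Big\{u\in L^p_{\rm loc}(\mathbb{R}^n):\ \sup_{x_0\in\mathbb{R}^n,\ \varrho>0}\varrho^{-n}\int_{B_\varrho(x_0)}|u-u_{x_0,\varrho}|^p\,dx<+\infty\Big\},\qquad u_{x_0,\varrho}=\frac{1}{|B_\varrho(x_0)|}\int_{B_\varrho(x_0)}u\,dx,$$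 be the Campanato space, and let $$\dot W^{s,p}(\mathbb{R}^n)=\big\{v\in\mathcal{L}^{p,n}(\mathbb{R}^n):\ [v]_{W^{s,p}}<+\infty\big\}\big/\!\sim_C,\qquad u\sim_C v\iff u-v\ \text{is constant almost everywhere},$$ endowed with $\|\{u\}_C\|=[u]_{W^{s,p}}$, where $\{u\}_C$ is the class of $u$. Then $\|\cdot\|$ is a norm on $\dot W^{s,p}(\mathbb{R}^n)$, for which it is a Banach space, and there exists a (surjective) linear isometric isomorphism $$\mathcal{J}:\mathcal{D}^{s,p}(\mathbb{R}^n)\to\dot W^{s,p}(\mathbb{R}^n),$$ which identifies the two spaces in the natural way: every $\varphi\in C_c^\infty(\mathbb{R}^n)$ belongs to $\mathcal{L}^{p,n}(\mathbb{R}^n)$ with $[\varphi]_{W^{s,p}}<+\infty$, and $\mathcal{J}$ maps the element of $\mathcal{D}^{s,p}(\mathbb{R}^n)$ given by $\varphi$ to $\{\varphi\}_C$. -/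

import Mathlib

noncomputable section

open MeasureTheory Set Metric
open scoped ENNReal ContDiff

namespace HomSobolev

/-- The Euclidean space `ℝⁿ`. -/
abbrev Euc (n : ℕ) : Type := EuclideanSpace ℝ (Fin n)

/-! ### Local Lebesgue spaces, weak gradients, Gagliardo-Slobodeckii seminorm -/

/-- `u ∈ L^p_loc(ℝⁿ)`. -/
def MemLpLoc (n : ℕ) (p : ℝ) (u : Euc n → ℝ) : Prop :=
  AEStronglyMeasurable u volume ∧
    ∀ K : Set (Euc n), IsCompact K → MemLp u (ENNReal.ofReal p) (volume.restrict K)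

/-- `φ ∈ C_c^∞(ℝⁿ)`. -/
def IsTest (n : ℕ) (φ : Euc n → ℝ) : Prop :=
  ContDiff ℝ ∞ φ ∧ HasCompactSupport φ

/-- `G` is the weak (distributional) gradient of `u`: it is locally integrable and
`∫ u ∂_v φ = - ∫ (G · v) φ` for every direction `v` and every `φ ∈ C_c^∞(ℝⁿ)`. -/
def IsWeakGradient (n : ℕ) (u : Euc n → ℝ) (G : Euc n → Euc n) : Prop :=
  LocallyIntegrable G volume ∧
    ∀ φ : Euc n → ℝ, IsTest n φ → ∀ v : Euc n,
      ∫ x, u x * fderiv ℝ φ x v = - ∫ x, inner ℝ (G x) v * φ x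

/-- The double integral `∬ |u(x) - u(y)|^p / |x - y|^(n + s p) dx dy`, with values in `[0, ∞]`. -/
def gagliardoIntegral (n : ℕ) (s p : ℝ) (u : Euc n → ℝ) : ℝ≥0∞ :=
  ∫⁻ z : Euc n × Euc n, ‖u z.1 - u z.2‖ₑ ^ p / ‖z.1 - z.2‖ₑ ^ ((n : ℝ) + s * p)

/-- `‖∇u‖_{L^p}` with values in `[0, ∞]`; it is `∞` if `u` has no weak gradient. (Weak gradients
are unique almost everywhere, so the infimum is over a single value.) -/
def gradNorm (n : ℕ) (p : ℝ) (u : Euc n → ℝ) : ℝ≥0∞ :=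
  ⨅ (G : Euc n → Euc n) (_ : IsWeakGradient n u G), eLpNorm G (ENNReal.ofReal p) volume

/-- The normalized Gagliardo-Slobodeckii seminorm `[u]_{W^{s,p}(ℝⁿ)}`, `s ∈ (0,1]`, with values
in `[0, ∞]`: for `s = 1` it is `‖∇u‖_{L^p}`, for `s ∈ (0,1)` it is
`(s (1-s) ∬ |u(x) - u(y)|^p / |x - y|^(n + s p) dx dy)^(1/p)`. -/
def gagliardo (n : ℕ) (s p : ℝ) (u : Euc n → ℝ) : ℝ≥0∞ :=
  open Classical in
  if s = 1 then gradNorm n p u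
  else (ENNReal.ofReal (s * (1 - s)) * gagliardoIntegral n s p u) ^ (1 / p)

/-! ### Campanato seminorm -/

/-- The Campanato seminorm `[u]_{𝓛^{p,λ}(ℝⁿ)}`, with values in `[0, ∞]`, the supremum over all
balls `B_ρ(x₀)` of `ρ^(-λ/p) (∫_{B_ρ(x₀)} |u - u_{x₀,ρ}|^p)^(1/p)`. -/
def campanato (n : ℕ) (p lam : ℝ) (u : Euc n → ℝ) : ℝ≥0∞ :=
  ⨆ (x₀ : Euc n) (ρ : ℝ) (_ : 0 < ρ),
    ENNReal.ofReal (ρ ^ (-lam / p)) *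
      (∫⁻ x in ball x₀ ρ, ‖u x - ⨍ y in ball x₀ ρ, u y‖ₑ ^ p) ^ (1 / p)

/-! ### Basic facts: these are seminorms -/

lemma minkowski {α : Type*} [MeasurableSpace α] {μ : Measure α} {p : ℝ} (hp : 1 ≤ p)
    {f g h : α → ℝ≥0∞} (hf : AEMeasurable f μ) (hg : AEMeasurable g μ) (hh : ∀ a, h a ≤ f a + g a) :
    (∫⁻ a, h a ^ p ∂μ) ^ (1 / p) ≤
      (∫⁻ a, f a ^ p ∂μ) ^ (1 / p) + (∫⁻ a, g a ^ p ∂μ) ^ (1 / p) := by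
  have hp0 : 0 ≤ p := by linarith
  refine le_trans ?_ (ENNReal.lintegral_Lp_add_le hf hg hp)
  refine ENNReal.rpow_le_rpow (lintegral_mono fun a => ?_) (by positivity)
  exact ENNReal.rpow_le_rpow (hh a) hp0

lemma MemLpLoc.locallyIntegrable {n : ℕ} {p : ℝ} (hp : 1 ≤ p) {u : Euc n → ℝ}
    (hu : MemLpLoc n p u) : LocallyIntegrable u volume := by
  rw [locallyIntegrable_iff]
  intro K hK
  have : IsFiniteMeasure (volume.restrict K) := ⟨by simpa using hK.measure_lt_top⟩
  exact (hu.2 K hK).integrable (by simpa using hp)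

lemma MemLpLoc.add {n : ℕ} {p : ℝ} {u v : Euc n → ℝ}
    (hu : MemLpLoc n p u) (hv : MemLpLoc n p v) : MemLpLoc n p (u + v) :=
  ⟨hu.1.add hv.1, fun K hK => (hu.2 K hK).add (hv.2 K hK)⟩

lemma MemLpLoc.smul {n : ℕ} {p : ℝ} {u : Euc n → ℝ} (c : ℝ)
    (hu : MemLpLoc n p u) : MemLpLoc n p (c • u) :=
  ⟨hu.1.const_smul c, fun K hK => (hu.2 K hK).const_smul c⟩

lemma memLpLoc_zero (n : ℕ) (p : ℝ) : MemLpLoc n p 0 :=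
  ⟨aestronglyMeasurable_zero, fun _ _ => MemLp.zero⟩

lemma integrable_mul_test {n : ℕ} {u ψ : Euc n → ℝ} (hu : LocallyIntegrable u volume)
    (hψ : Continuous ψ) (hc : HasCompactSupport ψ) : Integrable (fun x => u x * ψ x) volume := by
  have := hu.integrable_smul_left_of_hasCompactSupport hψ hc
  simpa [mul_comm] using this

lemma IsTest.continuous_fderiv {n : ℕ} {φ : Euc n → ℝ} (h : IsTest n φ) (v : Euc n) :
    Continuous (fun x => fderiv ℝ φ x v) :=
  (h.1.continuous_fderiv (by simp)).clm_apply continuous_const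

lemma IsTest.compact_fderiv {n : ℕ} {φ : Euc n → ℝ} (h : IsTest n φ) (v : Euc n) :
    HasCompactSupport (fun x => fderiv ℝ φ x v) :=
  h.2.fderiv_apply (𝕜 := ℝ) v

lemma locallyIntegrable_inner {n : ℕ} {G : Euc n → Euc n} (hG : LocallyIntegrable G volume)
    (v : Euc n) : LocallyIntegrable (fun x => inner ℝ (G x) v) volume := by
  rw [locallyIntegrable_iff] at hG ⊢
  intro K hK
  exact (hG K hK).inner_const v

lemma IsWeakGradient.add {n : ℕ} {u v : Euc n → ℝ} {G H : Euc n → Euc n}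
    (hu' : LocallyIntegrable u volume) (hv' : LocallyIntegrable v volume)
    (hu : IsWeakGradient n u G) (hv : IsWeakGradient n v H) :
    IsWeakGradient n (u + v) (G + H) := by
  refine ⟨hu.1.add hv.1, fun φ hφ w => ?_⟩
  have h1 := integrable_mul_test hu' (hφ.continuous_fderiv w) (hφ.compact_fderiv w)
  have h2 := integrable_mul_test hv' (hφ.continuous_fderiv w) (hφ.compact_fderiv w)
  have h3 := integrable_mul_test (locallyIntegrable_inner hu.1 w) hφ.1.continuous hφ.2
  have h4 := integrable_mul_test (locallyIntegrable_inner hv.1 w) hφ.1.continuous hφ.2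
  simp only [Pi.add_apply, add_mul, inner_add_left]
  rw [integral_add h1 h2, integral_add h3 h4, hu.2 φ hφ w, hv.2 φ hφ w]
  ring

lemma IsWeakGradient.smul {n : ℕ} {u : Euc n → ℝ} {G : Euc n → Euc n} (c : ℝ)
    (hu : IsWeakGradient n u G) : IsWeakGradient n (c • u) (c • G) := by
  refine ⟨hu.1.smul c, fun φ hφ w => ?_⟩
  simp only [Pi.smul_apply, smul_eq_mul, inner_smul_left, mul_assoc]
  simp [integral_const_mul, hu.2 φ hφ w]

lemma gradNorm_add_le {n : ℕ} {p : ℝ} (hp : 1 ≤ p) {u v : Euc n → ℝ}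
    (hu : LocallyIntegrable u volume) (hv : LocallyIntegrable v volume) :
    gradNorm n p (u + v) ≤ gradNorm n p u + gradNorm n p v := by
  unfold gradNorm
  rw [ENNReal.iInf₂_add]
  refine le_iInf₂ fun G hG => ?_
  rw [ENNReal.add_iInf₂]
  refine le_iInf₂ fun H hH => ?_
  refine (iInf₂_le (G + H) (hG.add hu hv hH)).trans ?_
  exact eLpNorm_add_le hG.1.aestronglyMeasurable hH.1.aestronglyMeasurable (by simpa using hp)

lemma gradNorm_zero (n : ℕ) (p : ℝ) : gradNorm n p 0 = 0 := by
  have h0 : IsWeakGradient n 0 0 := by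
    refine ⟨locallyIntegrable_zero, fun φ hφ w => by simp⟩
  refine le_antisymm ((iInf₂_le 0 h0).trans ?_) bot_le
  simp

lemma gradNorm_smul_le {n : ℕ} {p : ℝ} (c : ℝ) (u : Euc n → ℝ) :
    gradNorm n p (c • u) ≤ ‖c‖ₑ * gradNorm n p u := by
  rcases eq_or_ne c 0 with rfl | hc
  · simp [gradNorm_zero]
  have hc0 : ‖c‖ₑ ≠ 0 := by simpa using hc
  unfold gradNorm
  rw [ENNReal.mul_iInf_of_ne hc0 (by simp)]
  refine le_iInf fun G => ?_
  rw [ENNReal.mul_iInf_of_ne hc0 (by simp)]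
  refine le_iInf fun hG => ?_
  refine (iInf₂_le (c • G) (hG.smul c)).trans ?_
  exact (eLpNorm_const_smul c G _ _).le

lemma gagliardoIntegral_eq {n : ℕ} {s p : ℝ} (hp : 1 ≤ p) (u : Euc n → ℝ) :
    gagliardoIntegral n s p u = ∫⁻ z : Euc n × Euc n,
      (‖u z.1 - u z.2‖ₑ * ((‖z.1 - z.2‖ₑ ^ ((n : ℝ) + s * p))⁻¹) ^ (1 / p)) ^ p := by
  have hp0 : 0 < p := by linarith
  unfold gagliardoIntegral
  congr 1
  ext z
  rw [ENNReal.mul_rpow_of_nonneg _ _ hp0.le, ← ENNReal.rpow_mul, one_div_mul_cancel hp0.ne',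
    ENNReal.rpow_one, div_eq_mul_inv]

lemma aemeasurable_gagliardo {n : ℕ} {s p : ℝ} {u : Euc n → ℝ}
    (hu : AEStronglyMeasurable u volume) :
    AEMeasurable (fun z : Euc n × Euc n =>
      ‖u z.1 - u z.2‖ₑ * ((‖z.1 - z.2‖ₑ ^ ((n : ℝ) + s * p))⁻¹) ^ (1 / p)) volume := by
  have h1 : AEStronglyMeasurable (fun z : Euc n × Euc n => u z.1 - u z.2) volume :=
    (hu.comp_quasiMeasurePreserving Measure.quasiMeasurePreserving_fst).sub
      (hu.comp_quasiMeasurePreserving Measure.quasiMeasurePreserving_snd)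
  refine h1.enorm.mul (Measurable.aemeasurable ?_)
  fun_prop

lemma gagliardo_add_le {n : ℕ} {s p : ℝ} (hp : 1 ≤ p) {u v : Euc n → ℝ}
    (hu : MemLpLoc n p u) (hv : MemLpLoc n p v) :
    gagliardo n s p (u + v) ≤ gagliardo n s p u + gagliardo n s p v := by
  unfold gagliardo
  split_ifs with hs
  · exact gradNorm_add_le hp (hu.locallyIntegrable hp) (hv.locallyIntegrable hp)
  · have hp' : 0 ≤ 1 / p := by positivity
    simp only [ENNReal.mul_rpow_of_nonneg _ _ hp', ← mul_add]
    gcongr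
    simp only [gagliardoIntegral_eq hp]
    refine minkowski hp (aemeasurable_gagliardo hu.1) (aemeasurable_gagliardo hv.1) fun z => ?_
    rw [← add_mul]
    gcongr
    refine le_trans (le_of_eq ?_) (enorm_add_le _ _)
    congr 1
    simp only [Pi.add_apply]
    ring

lemma gagliardo_smul_le {n : ℕ} {s p : ℝ} (hp : 1 ≤ p) (c : ℝ) (u : Euc n → ℝ) :
    gagliardo n s p (c • u) ≤ ‖c‖ₑ * gagliardo n s p u := by
  unfold gagliardo
  split_ifs with hs
  · exact gradNorm_smul_le c u
  · have hp0 : 0 < p := by linarith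
    have hp' : 0 ≤ 1 / p := by positivity
    have : gagliardoIntegral n s p (c • u) = ‖c‖ₑ ^ p * gagliardoIntegral n s p u := by
      unfold gagliardoIntegral
      rw [← lintegral_const_mul' _ _ (by simp [hp0.le])]
      congr 1
      ext z
      simp only [Pi.smul_apply, ← smul_sub, enorm_smul, ENNReal.mul_rpow_of_nonneg _ _ hp0.le,
        mul_div_assoc]
    rw [this, mul_left_comm, ENNReal.mul_rpow_of_nonneg _ _ hp', ← ENNReal.rpow_mul,
      mul_one_div_cancel hp0.ne', ENNReal.rpow_one]

lemma gagliardo_zero {n : ℕ} {s p : ℝ} (hp : 1 ≤ p) : gagliardo n s p 0 = 0 := by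
  have := gagliardo_smul_le (n := n) (s := s) hp 0 0
  simpa using this

lemma campanato_zero {n : ℕ} {p lam : ℝ} (hp : 1 ≤ p) : campanato n p lam 0 = 0 := by
  have hp0 : 0 < p := by linarith
  simp [campanato, hp0]

lemma campanato_add_le {n : ℕ} {p lam : ℝ} (hp : 1 ≤ p) {u v : Euc n → ℝ}
    (hu : MemLpLoc n p u) (hv : MemLpLoc n p v) :
    campanato n p lam (u + v) ≤ campanato n p lam u + campanato n p lam v := by
  refine iSup_le fun x₀ => iSup₂_le fun ρ hρ => ?_
  refine le_trans ?_ (add_le_add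
    (le_iSup_of_le x₀ (le_iSup₂_of_le ρ hρ le_rfl)) (le_iSup_of_le x₀ (le_iSup₂_of_le ρ hρ le_rfl)))
  rw [← mul_add]
  gcongr
  have hint : ∀ {w : Euc n → ℝ}, MemLpLoc n p w → IntegrableOn w (ball x₀ ρ) volume := by
    intro w hw
    exact ((hw.locallyIntegrable hp).integrableOn_isCompact (isCompact_closedBall x₀ ρ)).mono_set
      ball_subset_closedBall
  refine minkowski hp (hu.1.restrict.sub aestronglyMeasurable_const).enorm
    (hv.1.restrict.sub aestronglyMeasurable_const).enorm fun x => ?_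
  refine le_trans (le_of_eq ?_) (enorm_add_le _ _)
  congr 1
  have : ⨍ y in ball x₀ ρ, (u + v) y = (⨍ y in ball x₀ ρ, u y) + ⨍ y in ball x₀ ρ, v y := by
    simp only [setAverage_eq, Pi.add_apply]
    rw [integral_add (hint hu) (hint hv), smul_add]
  rw [this, Pi.add_apply]
  ring

lemma campanato_smul_le {n : ℕ} {p lam : ℝ} (hp : 1 ≤ p) (c : ℝ) (u : Euc n → ℝ) :
    campanato n p lam (c • u) ≤ ‖c‖ₑ * campanato n p lam u := by
  have hp0 : 0 < p := by linarith
  have hp' : 0 ≤ 1 / p := by positivity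
  refine iSup_le fun x₀ => iSup₂_le fun ρ hρ => ?_
  refine le_trans (le_of_eq ?_) (mul_le_mul_right
    (le_iSup_of_le x₀ (le_iSup₂_of_le ρ hρ le_rfl)) _)
  rw [mul_left_comm]
  congr 1
  have : ∀ x, ‖(c • u) x - ⨍ y in ball x₀ ρ, (c • u) y‖ₑ ^ p =
      ‖c‖ₑ ^ p * ‖u x - ⨍ y in ball x₀ ρ, u y‖ₑ ^ p := by
    intro x
    rw [← ENNReal.mul_rpow_of_nonneg _ _ hp0.le, ← enorm_smul, smul_sub]
    congr 3
    simp only [setAverage_eq, Pi.smul_apply]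
    rw [integral_smul, smul_comm]
  simp only [this]
  rw [lintegral_const_mul' _ _ (by simp [hp0.le]), ENNReal.mul_rpow_of_nonneg _ _ hp',
    ← ENNReal.rpow_mul, mul_one_div_cancel hp0.ne', ENNReal.rpow_one]

/-! ### The quotient space `Ẇ^{s,p}` -/

/-- The Campanato space `𝓛^{p,λ}(ℝⁿ)`, as a space of functions. -/
def campanatoSpace (n : ℕ) (p lam : ℝ) (hp : 1 ≤ p) : Submodule ℝ (Euc n → ℝ) where
  carrier := {u | MemLpLoc n p u ∧ campanato n p lam u < ⊤}
  zero_mem' := ⟨memLpLoc_zero n p, by simp [campanato_zero hp]⟩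
  add_mem' := fun {u v} hu hv => ⟨hu.1.add hv.1,
    (campanato_add_le hp hu.1 hv.1).trans_lt (ENNReal.add_lt_top.2 ⟨hu.2, hv.2⟩)⟩
  smul_mem' := fun c u hu => ⟨hu.1.smul c,
    (campanato_smul_le hp c u).trans_lt (ENNReal.mul_lt_top (by simp) hu.2)⟩

/-- The space `{v ∈ 𝓛^{p,n}(ℝⁿ) : [v]_{W^{s,p}(ℝⁿ)} < ∞}`, as a space of functions. -/
def preW (n : ℕ) (s p : ℝ) (hp : 1 ≤ p) : Submodule ℝ (Euc n → ℝ) where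
  carrier := {v | v ∈ campanatoSpace n p n hp ∧ gagliardo n s p v < ⊤}
  zero_mem' := ⟨zero_mem _, by simp [gagliardo_zero hp]⟩
  add_mem' := fun {u v} hu hv => ⟨add_mem hu.1 hv.1,
    (gagliardo_add_le hp hu.1.1 hv.1.1).trans_lt (ENNReal.add_lt_top.2 ⟨hu.2, hv.2⟩)⟩
  smul_mem' := fun c u hu => ⟨Submodule.smul_mem _ c hu.1,
    (gagliardo_smul_le hp c u).trans_lt (ENNReal.mul_lt_top (by simp) hu.2)⟩

/-- The functions that are constant almost everywhere. -/
def aeConst (n : ℕ) : Submodule ℝ (Euc n → ℝ) where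
  carrier := {u | ∃ c : ℝ, ∀ᵐ x, u x = c}
  zero_mem' := ⟨0, by simp⟩
  add_mem' := by
    rintro u v ⟨a, ha⟩ ⟨b, hb⟩
    refine ⟨a + b, ?_⟩
    filter_upwards [ha, hb] with x h1 h2
    simp [h1, h2]
  smul_mem' := by
    rintro c u ⟨a, ha⟩
    refine ⟨c * a, ?_⟩
    filter_upwards [ha] with x h1
    simp [h1]

/-- `Ẇ^{s,p}(ℝⁿ) = {v ∈ 𝓛^{p,n}(ℝⁿ) : [v]_{W^{s,p}(ℝⁿ)} < ∞} / ∼`, where `u ∼ v` means that `u - v`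
is constant almost everywhere (the definition is used for `s p = n`). -/
def WDot (n : ℕ) (s p : ℝ) (hp : 1 ≤ p) : Type :=
  preW n s p hp ⧸ (aeConst n).submoduleOf (preW n s p hp)

instance (n : ℕ) (s p : ℝ) (hp : 1 ≤ p) : AddCommGroup (WDot n s p hp) :=
  inferInstanceAs (AddCommGroup (preW n s p hp ⧸ (aeConst n).submoduleOf (preW n s p hp)))

instance (n : ℕ) (s p : ℝ) (hp : 1 ≤ p) : Module ℝ (WDot n s p hp) :=
  inferInstanceAs (Module ℝ (preW n s p hp ⧸ (aeConst n).submoduleOf (preW n s p hp)))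

/-- The class `{v}` of `v` modulo constants. -/
def WDot.mk {n : ℕ} {s p : ℝ} {hp : 1 ≤ p} : preW n s p hp →ₗ[ℝ] WDot n s p hp :=
  ((aeConst n).submoduleOf (preW n s p hp)).mkQ

lemma gagliardo_aeConst {n : ℕ} {s p : ℝ} (hp : 1 ≤ p) {u : Euc n → ℝ} (hu : u ∈ aeConst n) :
    gagliardo n s p u = 0 := by
  obtain ⟨c, hc⟩ := hu
  have hp0 : 0 < p := by linarith
  unfold gagliardo
  split_ifs with hs
  · have h0 : IsWeakGradient n u 0 := by
      refine ⟨locallyIntegrable_zero, fun φ hφ w => ?_⟩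
      have h1 : ∫ x, u x * fderiv ℝ φ x w = ∫ x, (fun _ => c) x * fderiv ℝ φ x w := by
        refine integral_congr_ae ?_
        filter_upwards [hc] with x hx
        rw [hx]
      have h3 := integral_mul_fderiv_eq_neg_fderiv_mul_of_integrable (μ := volume)
        (f := fun _ : Euc n => c) (g := φ) (v := w) (by simp)
        (((hφ.continuous_fderiv w).integrable_of_hasCompactSupport (hφ.compact_fderiv w)).const_mul c)
        ((hφ.1.continuous.integrable_of_hasCompactSupport hφ.2).const_mul c)
        (fun x _ => by fun_prop) (fun x _ => (hφ.1.differentiable (by simp)) x)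
      rw [h1, h3]
      simp
    refine le_antisymm ((iInf₂_le 0 h0).trans ?_) bot_le
    simp
  · have : gagliardoIntegral n s p u = 0 := by
      unfold gagliardoIntegral
      have h1 : ∀ᵐ z : Euc n × Euc n, u z.1 = c :=
        Measure.quasiMeasurePreserving_fst.ae hc
      have h2 : ∀ᵐ z : Euc n × Euc n, u z.2 = c :=
        Measure.quasiMeasurePreserving_snd.ae hc
      rw [← lintegral_zero (μ := (volume : Measure (Euc n × Euc n)))]
      refine lintegral_congr_ae ?_
      filter_upwards [h1, h2] with z h1 h2
      simp [h1, h2, hp0]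
    simp [this, hp0]

lemma memLpLoc_of_mem_preW {n : ℕ} {s p : ℝ} {hp : 1 ≤ p} (u : preW n s p hp) :
    MemLpLoc n p u.1 := u.2.1.1

lemma gagliardo_toReal_add_le {n : ℕ} {s p : ℝ} (hp : 1 ≤ p) {u v : Euc n → ℝ}
    (hu : MemLpLoc n p u) (hv : MemLpLoc n p v)
    (hu' : gagliardo n s p u < ⊤) (hv' : gagliardo n s p v < ⊤) :
    (gagliardo n s p (u + v)).toReal ≤ (gagliardo n s p u).toReal + (gagliardo n s p v).toReal := by
  rw [← ENNReal.toReal_add hu'.ne hv'.ne]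
  exact ENNReal.toReal_mono (ENNReal.add_lt_top.2 ⟨hu', hv'⟩).ne (gagliardo_add_le hp hu hv)

lemma gagliardo_toReal_smul_le {n : ℕ} {s p : ℝ} (hp : 1 ≤ p) (c : ℝ) {u : Euc n → ℝ}
    (hu' : gagliardo n s p u < ⊤) :
    (gagliardo n s p (c • u)).toReal ≤ ‖c‖ * (gagliardo n s p u).toReal := by
  have := ENNReal.toReal_mono (ENNReal.mul_lt_top (by simp) hu').ne
    (gagliardo_smul_le (s := s) hp c u)
  simpa using this

lemma gagliardo_neg {n : ℕ} {s p : ℝ} (hp : 1 ≤ p) (u : Euc n → ℝ) :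
    gagliardo n s p (-u) = gagliardo n s p u := by
  have h : ∀ v : Euc n → ℝ, gagliardo n s p (-v) ≤ gagliardo n s p v := by
    intro v
    have := gagliardo_smul_le (s := s) hp (-1) v
    simpa using this
  refine le_antisymm (h u) ?_
  have := h (-u)
  simpa using this

/-- The norm `‖{u}‖ = [u]_{W^{s,p}(ℝⁿ)}` on `Ẇ^{s,p}(ℝⁿ)`. -/
def WDot.norm {n : ℕ} {s p : ℝ} {hp : 1 ≤ p} : WDot n s p hp → ℝ :=
  Quotient.lift (fun u : preW n s p hp => (gagliardo n s p u.1).toReal) (by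
    have key : ∀ a b : preW n s p hp, (a - b : preW n s p hp).1 ∈ aeConst n →
        gagliardo n s p a.1 ≤ gagliardo n s p b.1 := by
      intro a b h
      have h1 := gagliardo_add_le (s := s) hp (memLpLoc_of_mem_preW (a - b))
        (memLpLoc_of_mem_preW b)
      rw [gagliardo_aeConst hp h, zero_add] at h1
      simpa using h1
    intro a b hab
    have h : (a - b : preW n s p hp).1 ∈ aeConst n :=
      (Submodule.quotientRel_def ((aeConst n).submoduleOf (preW n s p hp))).1 hab
    have h' : (b - a : preW n s p hp).1 ∈ aeConst n := by
      have := neg_mem h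
      rwa [← Submodule.coe_neg, neg_sub] at this
    exact congrArg ENNReal.toReal (le_antisymm (key a b h) (key b a h')))

instance (n : ℕ) (s p : ℝ) (hp : 1 ≤ p) : SeminormedAddCommGroup (WDot n s p hp) :=
  AddGroupSeminorm.toSeminormedAddCommGroup
    { toFun := WDot.norm
      map_zero' := by
        change (gagliardo n s p 0).toReal = 0
        simp [gagliardo_zero hp]
      add_le' := by
        intro a b
        induction a using Quotient.inductionOn with | _ a
        induction b using Quotient.inductionOn with | _ b
        exact gagliardo_toReal_add_le hp (memLpLoc_of_mem_preW a) (memLpLoc_of_mem_preW b)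
          a.2.2 b.2.2
      neg' := by
        intro a
        induction a using Quotient.inductionOn with | _ a
        exact congrArg ENNReal.toReal (gagliardo_neg hp a.1) }

instance (n : ℕ) (s p : ℝ) (hp : 1 ≤ p) : NormedSpace ℝ (WDot n s p hp) where
  norm_smul_le := by
    intro c a
    induction a using Quotient.inductionOn with | _ a
    exact gagliardo_toReal_smul_le hp c a.2.2

lemma WDot.norm_mk {n : ℕ} {s p : ℝ} {hp : 1 ≤ p} (u : preW n s p hp) :
    ‖(WDot.mk u : WDot n s p hp)‖ = (gagliardo n s p u.1).toReal := rfl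

lemma WDot.mk_eq_mk_iff {n : ℕ} {s p : ℝ} {hp : 1 ≤ p} (u v : preW n s p hp) :
    (WDot.mk u : WDot n s p hp) = WDot.mk v ↔ ∃ c : ℝ, ∀ᵐ x, u.1 x - v.1 x = c :=
  Submodule.Quotient.eq _

/-! ### The homogeneous Sobolev space `𝓓^{s,p}` -/

lemma integrable_profile {n : ℕ} (hn : 0 < n) {s p L B : ℝ} (hp : 1 ≤ p) (hs0 : 0 < s) (hs1 : s < 1)
    (hL : 0 ≤ L) (hB : 0 ≤ B) :
    Integrable (fun x : Euc n => (min (L * ‖x‖) B) ^ p / ‖x‖ ^ ((n : ℝ) + s * p)) volume := by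
  have : Nonempty (Fin n) := ⟨⟨0, hn⟩⟩
  have hp0 : 0 < p := by linarith
  have := integrable_fun_norm_addHaar (volume : Measure (Euc n))
    (f := fun r : ℝ => (min (L * r) B) ^ p / r ^ ((n : ℝ) + s * p))
  refine this.2 ?_
  simp only [finrank_euclideanSpace, Fintype.card_fin, smul_eq_mul]
  have hmeas : Measurable fun y : ℝ =>
      y ^ (n - 1) * ((min (L * y) B) ^ p / y ^ ((n : ℝ) + s * p)) := by fun_prop
  have hpow : ∀ y : ℝ, 0 < y → y ^ (n - 1) / y ^ ((n : ℝ) + s * p) = y ^ (-1 - s * p) := by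
    intro y hy
    rw [← Real.rpow_natCast, ← Real.rpow_sub hy, Nat.cast_sub hn]
    congr 1
    push_cast
    ring
  rw [← Ioc_union_Ioi_eq_Ioi (zero_le_one' ℝ)]
  refine IntegrableOn.union ?_ ?_
  · have h1 : IntegrableOn (fun y : ℝ => L ^ p * y ^ (p - 1 - s * p)) (Ioc 0 1) volume := by
      refine Integrable.const_mul ?_ _
      have := intervalIntegral.intervalIntegrable_rpow' (a := 0) (b := 1)
        (r := p - 1 - s * p) (by nlinarith)
      rwa [intervalIntegrable_iff_integrableOn_Ioc_of_le zero_le_one] at this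
    refine Integrable.mono' h1 hmeas.aestronglyMeasurable ?_
    refine (ae_restrict_iff' measurableSet_Ioc).2 (Filter.Eventually.of_forall fun y hy => ?_)
    have hy0 : 0 < y := hy.1
    have hm : 0 ≤ min (L * y) B := le_min (by positivity) hB
    rw [Real.norm_of_nonneg (by positivity)]
    calc y ^ (n - 1) * (min (L * y) B ^ p / y ^ ((n : ℝ) + s * p))
        = (min (L * y) B) ^ p * y ^ (-1 - s * p) := by rw [← hpow y hy0]; ring
      _ ≤ (L * y) ^ p * y ^ (-1 - s * p) := by
          gcongr
          exact min_le_left _ _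
      _ = L ^ p * y ^ (p - 1 - s * p) := by
          rw [Real.mul_rpow hL hy0.le, mul_assoc, ← Real.rpow_add hy0]
          congr 2
          ring
  · have h1 : IntegrableOn (fun y : ℝ => B ^ p * y ^ (-1 - s * p)) (Ioi 1) volume := by
      refine Integrable.const_mul ?_ _
      exact integrableOn_Ioi_rpow_of_lt (by nlinarith) one_pos
    refine Integrable.mono' h1 hmeas.aestronglyMeasurable ?_
    refine (ae_restrict_iff' measurableSet_Ioi).2 (Filter.Eventually.of_forall fun y hy => ?_)
    have hy0 : 0 < y := lt_trans one_pos hy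
    have hm : 0 ≤ min (L * y) B := le_min (by positivity) hB
    rw [Real.norm_of_nonneg (by positivity)]
    calc y ^ (n - 1) * (min (L * y) B ^ p / y ^ ((n : ℝ) + s * p))
        = (min (L * y) B) ^ p * y ^ (-1 - s * p) := by rw [← hpow y hy0]; ring
      _ ≤ B ^ p * y ^ (-1 - s * p) := by
          gcongr
          exact min_le_right _ _

lemma gagliardoIntegral_test_lt_top {n : ℕ} {s p : ℝ} (hp : 1 ≤ p) (hs0 : 0 < s) (hs1 : s < 1)
    {φ : Euc n → ℝ} (hφ : IsTest n φ) : gagliardoIntegral n s p φ < ⊤ := by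
  have hp0 : 0 < p := by linarith
  rcases Nat.eq_zero_or_pos n with rfl | hn
  · have : gagliardoIntegral 0 s p φ = 0 := by
      unfold gagliardoIntegral
      rw [← lintegral_zero (μ := (volume : Measure (Euc 0 × Euc 0)))]
      congr 1
      ext z
      rw [Subsingleton.elim z.1 z.2]
      simp [hp0]
    simp [this]
  obtain ⟨L, hL⟩ := ContDiff.lipschitzWith_of_hasCompactSupport hφ.2 hφ.1 (by simp)
  obtain ⟨M, hM⟩ := hφ.1.continuous.bounded_above_of_compact_support hφ.2
  have hM0 : 0 ≤ M := (norm_nonneg _).trans (hM 0)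
  set F : Euc n → ℝ := fun x => (min ((L : ℝ) * ‖x‖) (2 * M)) ^ p / ‖x‖ ^ ((n : ℝ) + s * p) with hF
  have hFint : Integrable F volume := integrable_profile hn hp hs0 hs1 L.2 (by positivity)
  set g : Euc n → ℝ≥0∞ := fun x => ENNReal.ofReal (F x) with hg
  have hgint : ∫⁻ x, g x < ⊤ := hFint.lintegral_lt_top
  have hgm : Measurable g := by
    simp only [hg, hF]
    fun_prop
  set K := tsupport φ
  have hK : MeasurableSet K := (isClosed_tsupport φ).measurableSet
  have hKf : volume K < ⊤ := hφ.2.isCompact.measure_lt_top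
  have hle : ∀ x y : Euc n, ‖φ x - φ y‖ₑ ^ p / ‖x - y‖ₑ ^ ((n : ℝ) + s * p) ≤ g (x - y) := by
    intro x y
    rcases eq_or_ne x y with rfl | hxy
    · simp [hp0]
    have hpos : 0 < ‖x - y‖ := norm_pos_iff.2 (sub_ne_zero.2 hxy)
    rw [← ofReal_norm, ← ofReal_norm, ENNReal.ofReal_rpow_of_nonneg (norm_nonneg _) hp0.le,
      ENNReal.ofReal_rpow_of_pos hpos, ← ENNReal.ofReal_div_of_pos (by positivity)]
    refine ENNReal.ofReal_le_ofReal ?_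
    simp only [hF]
    gcongr
    refine le_min ?_ ?_
    · simpa [dist_eq_norm] using hL.dist_le_mul x y
    · refine (norm_sub_le _ _).trans ?_
      linarith [hM x, hM y]
  have hz : ∀ z : Euc n × Euc n, ‖φ z.1 - φ z.2‖ₑ ^ p / ‖z.1 - z.2‖ₑ ^ ((n : ℝ) + s * p) ≤
      K.indicator 1 z.1 * g (z.1 - z.2) + K.indicator 1 z.2 * g (z.1 - z.2) := by
    intro z
    by_cases h1 : z.1 ∈ K
    · refine (hle _ _).trans ?_
      simp [h1]
    by_cases h2 : z.2 ∈ K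
    · refine (hle _ _).trans ?_
      simp [h2]
    · simp [image_eq_zero_of_notMem_tsupport h1, image_eq_zero_of_notMem_tsupport h2, hp0]
  have hind : Measurable (K.indicator (1 : Euc n → ℝ≥0∞)) := measurable_one.indicator hK
  unfold gagliardoIntegral
  refine (lintegral_mono hz).trans_lt ?_
  rw [lintegral_add_left (by fun_prop), Measure.volume_eq_prod]
  refine ENNReal.add_lt_top.2 ⟨?_, ?_⟩
  · rw [lintegral_prod _ (by fun_prop)]
    have : ∀ x : Euc n, ∫⁻ y, K.indicator 1 x * g (x - y) = K.indicator 1 x * ∫⁻ y, g y := by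
      intro x
      rw [lintegral_const_mul _ (by fun_prop), lintegral_sub_left_eq_self g x]
    simp only [this]
    rw [lintegral_mul_const _ hind, lintegral_indicator_one hK]
    exact ENNReal.mul_lt_top hKf hgint
  · rw [lintegral_prod_symm _ (by fun_prop)]
    have : ∀ y : Euc n, ∫⁻ x, K.indicator 1 y * g (x - y) = K.indicator 1 y * ∫⁻ x, g x := by
      intro y
      rw [lintegral_const_mul _ (by fun_prop), lintegral_sub_right_eq_self g y]
    simp only [this]
    rw [lintegral_mul_const _ hind, lintegral_indicator_one hK]
    exact ENNReal.mul_lt_top hKf hgint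

lemma isWeakGradient_test {n : ℕ} {φ : Euc n → ℝ} (hφ : IsTest n φ) :
    IsWeakGradient n φ (gradient φ) := by
  have hc : Continuous (gradient φ) := by
    unfold gradient
    exact (LinearIsometryEquiv.continuous _).comp (hφ.1.continuous_fderiv (by simp))
  refine ⟨hc.locallyIntegrable, fun ψ hψ v => ?_⟩
  have hin : ∀ x, inner ℝ (gradient φ x) v = fderiv ℝ φ x v := by
    intro x
    simp [gradient]
  simp only [hin]
  have hd : ∀ {χ : Euc n → ℝ}, IsTest n χ → Differentiable ℝ χ :=
    fun h => h.1.differentiable (by simp)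
  refine integral_mul_fderiv_eq_neg_fderiv_mul_of_integrable ?_ ?_ ?_
    (fun x _ => hd hφ x) (fun x _ => hd hψ x)
  · exact integrable_mul_test (hφ.continuous_fderiv v).locallyIntegrable hψ.1.continuous hψ.2
  · exact integrable_mul_test hφ.1.continuous.locallyIntegrable (hψ.continuous_fderiv v)
      (hψ.compact_fderiv v)
  · exact integrable_mul_test hφ.1.continuous.locallyIntegrable hψ.1.continuous hψ.2

lemma gradNorm_test_lt_top {n : ℕ} {p : ℝ} {φ : Euc n → ℝ} (hφ : IsTest n φ) :
    gradNorm n p φ < ⊤ := by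
  refine (iInf₂_le _ (isWeakGradient_test hφ)).trans_lt ?_
  have hc : Continuous (gradient φ) := by
    unfold gradient
    exact (LinearIsometryEquiv.continuous _).comp (hφ.1.continuous_fderiv (by simp))
  have hs : HasCompactSupport (gradient φ) := by
    unfold gradient
    exact (hφ.2.fderiv (𝕜 := ℝ)).comp_left (map_zero _)
  exact (hc.memLp_of_hasCompactSupport hs).eLpNorm_lt_top

/-- Test functions have finite Gagliardo-Slobodeckii seminorm. (For `s ∉ (0,1]`, which is
irrelevant, the factor `s (1 - s)` is replaced by `0`.) -/
lemma gagliardo_test_lt_top {n : ℕ} {s p : ℝ} (hp : 1 ≤ p) {φ : Euc n → ℝ} (hφ : IsTest n φ) :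
    gagliardo n s p φ < ⊤ := by
  have hp0 : 0 < p := by linarith
  unfold gagliardo
  split_ifs with hs
  · exact gradNorm_test_lt_top hφ
  · refine ENNReal.rpow_lt_top_of_nonneg (by positivity) ?_
    by_cases h : 0 < s ∧ s < 1
    · exact (ENNReal.mul_lt_top (by simp)
        (gagliardoIntegral_test_lt_top hp h.1 h.2 hφ)).ne
    · have : s * (1 - s) ≤ 0 := by
        by_contra! h'
        rcases pos_and_pos_or_neg_and_neg_of_mul_pos h' with h1 | h1
        · exact h ⟨h1.1, by linarith [h1.2]⟩
        · linarith [h1.1, h1.2]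
      simp [ENNReal.ofReal_of_nonpos this]

lemma IsTest.memLpLoc {n : ℕ} {p : ℝ} {φ : Euc n → ℝ} (hφ : IsTest n φ) : MemLpLoc n p φ :=
  ⟨hφ.1.continuous.aestronglyMeasurable,
    fun _ _ => (hφ.1.continuous.memLp_of_hasCompactSupport hφ.2).restrict _⟩

/-- `C_c^∞(ℝⁿ)` as a space of functions. -/
def testSpace (n : ℕ) : Submodule ℝ (Euc n → ℝ) where
  carrier := {φ | IsTest n φ}
  zero_mem' := ⟨contDiff_const, HasCompactSupport.zero⟩
  add_mem' := fun hu hv => ⟨hu.1.add hv.1, hu.2.add hv.2⟩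
  smul_mem' := fun _ _ hu => ⟨contDiff_const.smul hu.1, hu.2.smul_left⟩

/-- `C_c^∞(ℝⁿ)` endowed with `[·]_{W^{s,p}(ℝⁿ)}`. -/
def TestW (n : ℕ) (_s p : ℝ) (_hp : 1 ≤ p) : Type := testSpace n

instance (n : ℕ) (s p : ℝ) (hp : 1 ≤ p) : AddCommGroup (TestW n s p hp) :=
  inferInstanceAs (AddCommGroup (testSpace n))

instance (n : ℕ) (s p : ℝ) (hp : 1 ≤ p) : Module ℝ (TestW n s p hp) :=
  inferInstanceAs (Module ℝ (testSpace n))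

/-- The function underlying an element of `TestW`. -/
def TestW.toFun {n : ℕ} {s p : ℝ} {hp : 1 ≤ p} (φ : TestW n s p hp) : Euc n → ℝ :=
  Subtype.val (p := fun u => u ∈ testSpace n) φ

lemma TestW.isTest {n : ℕ} {s p : ℝ} {hp : 1 ≤ p} (φ : TestW n s p hp) : IsTest n φ.toFun :=
  Subtype.property (p := fun u => u ∈ testSpace n) φ

instance (n : ℕ) (s p : ℝ) (hp : 1 ≤ p) : SeminormedAddCommGroup (TestW n s p hp) :=
  AddGroupSeminorm.toSeminormedAddCommGroup
    { toFun := fun φ => (gagliardo n s p φ.toFun).toReal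
      map_zero' := by
        change (gagliardo n s p 0).toReal = 0
        simp [gagliardo_zero hp]
      add_le' := fun a b => gagliardo_toReal_add_le hp a.isTest.memLpLoc b.isTest.memLpLoc
        (gagliardo_test_lt_top hp a.isTest) (gagliardo_test_lt_top hp b.isTest)
      neg' := fun a => congrArg ENNReal.toReal (gagliardo_neg hp a.toFun) }

instance (n : ℕ) (s p : ℝ) (hp : 1 ≤ p) : NormedSpace ℝ (TestW n s p hp) where
  norm_smul_le := fun c a =>
    gagliardo_toReal_smul_le hp c (gagliardo_test_lt_top hp a.isTest)

lemma TestW.norm_eq {n : ℕ} {s p : ℝ} {hp : 1 ≤ p} (φ : TestW n s p hp) :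
    ‖φ‖ = (gagliardo n s p φ.toFun).toReal := rfl

/-- The homogeneous Sobolev space `𝓓^{s,p}(ℝⁿ)`: the completion of `C_c^∞(ℝⁿ)` with respect to
`[·]_{W^{s,p}(ℝⁿ)}`, a Banach space. -/
abbrev DSpace (n : ℕ) (s p : ℝ) (hp : 1 ≤ p) : Type :=
  UniformSpace.Completion (TestW n s p hp)

lemma one_le_exponent {n : ℕ} {s : ℝ} (hs : 0 < s) (hsn : s < n) : 1 ≤ (n : ℝ) / s :=
  (one_le_div hs).2 hsn.le

end HomSobolev

end

noncomputable section

open MeasureTheory Set Metric Filter Topology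
open scoped ENNReal ContDiff Convolution

namespace HomSobolev

/-! Everything rests on the critical relation `s * p = n`, for which the seminorm is invariant under
dilations `u(·/r)`. Throughout, the seminorm is treated as an `L^p` norm, up to a constant: of the
difference quotient `diffQuot` on the product space when `s < 1`, of the weak gradient when `s = 1`.

Poincaré inequality (`exists_lintegral_ball_prod_le`): on a ball `B` of radius `ρ`, the integral of
`|u(x) - u(y)|^p` over `B × B` is at most `C ρ^(2n) [u]^p`. By Jensen, `ρ^(-n) ∫_B |u - u_B|^p` is
then bounded by `C [u]^p` uniformly in `B`, so the Campanato condition follows from finiteness of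
the seminorm (`campanato_lt_top`). The same inequality bounds a function with zero mean on the unit
ball in `L^p` of every ball (`exists_eLpNorm_ball_le`). This gives definiteness, and also
completeness: a Cauchy sequence of classes has centered representatives that converge in `L^p_loc`,
and the limit is identified through `L^p` completeness of the difference quotients or gradients.

Density of test functions (`exists_isTest_gagliardo_sub_le`): mollify, truncate to a bounded smooth
function, then multiply by a cut-off. The cut-off is where criticality and `p > 1` matter. All
dilates of a bump have the same seminorm, and if the scales are far apart their difference quotients
(or gradients) are almost disjointly supported. A sum of `N` of them has norm of order `N^(1/p)`, so
their average has norm of order `N^(1/p - 1)`, which tends to zero, while it still equals `1` on a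
prescribed ball (`exists_cutoff`).

Hence test functions embed isometrically, with dense range, into a complete separated space, and the
embedding extends to an isometric isomorphism from their completion. -/

/-! ### Averages, translations and disjoint sums in `L^p` -/

/-- Minkowski's integral inequality for a probability average: Jensen in `t` for almost every `x`,
then Tonelli. It serves both mollification and averaging along a segment. -/
theorem eLpNorm_integral_le {T X E : Type*} [MeasurableSpace T] [MeasurableSpace X]
    [NormedAddCommGroup E] [NormedSpace ℝ E] {ν : Measure T} [IsProbabilityMeasure ν]
    {μ : Measure X} [SFinite μ] {F : T → X → E} {p : ℝ≥0∞}
    (hF : AEStronglyMeasurable (Function.uncurry F) (ν.prod μ)) (hp : 1 ≤ p) (hp' : p ≠ ⊤)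
    {C : ℝ≥0∞} (hC : ∀ᵐ t ∂ν, eLpNorm (F t) p μ ≤ C) :
    eLpNorm (fun x => ∫ t, F t x ∂ν) p μ ≤ C := by
  have hp0 : p ≠ 0 := (one_pos.trans_le hp).ne'
  have hr : 1 ≤ p.toReal := by
    rwa [← ENNReal.ofReal_le_iff_le_toReal hp', ENNReal.ofReal_one]
  have hr0 : 0 < p.toReal := one_pos.trans_le hr
  have hm : ∀ᵐ x ∂μ, AEStronglyMeasurable (fun t => F t x) ν := hF.prod_swap.prodMk_left
  have h1 : ∀ᵐ x ∂μ, ‖∫ t, F t x ∂ν‖ₑ ^ p.toReal ≤ ∫⁻ t, ‖F t x‖ₑ ^ p.toReal ∂ν := by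
    filter_upwards [hm] with x hx
    have h := eLpNorm'_le_eLpNorm'_of_exponent_le (μ := ν) one_pos hr hx
    rw [eLpNorm'_eq_lintegral_enorm, eLpNorm'_eq_lintegral_enorm] at h
    simp only [ENNReal.rpow_one, div_one] at h
    rw [← ENNReal.le_rpow_inv_iff hr0, ← one_div]
    exact (enorm_integral_le_lintegral_enorm _).trans h
  have h2 : ∫⁻ x, ‖∫ t, F t x ∂ν‖ₑ ^ p.toReal ∂μ ≤ C ^ p.toReal := by
    refine (lintegral_mono_ae h1).trans ?_
    rw [lintegral_lintegral_swap (hF.prod_swap.enorm.pow_const _)]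
    calc ∫⁻ t, ∫⁻ x, ‖F t x‖ₑ ^ p.toReal ∂μ ∂ν ≤ ∫⁻ _, C ^ p.toReal ∂ν := by
          refine lintegral_mono_ae ?_
          filter_upwards [hC] with t ht
          rw [eLpNorm_eq_lintegral_rpow_enorm_toReal hp0 hp', one_div,
            ENNReal.rpow_inv_le_iff hr0] at ht
          exact ht
      _ = C ^ p.toReal := by simp
  rw [eLpNorm_eq_lintegral_rpow_enorm_toReal hp0 hp', one_div, ENNReal.rpow_inv_le_iff hr0]
  exact h2

theorem tendsto_eLpNorm_zero_of_dominated {X E : Type*} [MeasurableSpace X]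
    [NormedAddCommGroup E] {μ : Measure X} {p : ℝ≥0∞} (hp0 : p ≠ 0) (hp' : p ≠ ⊤)
    {F : ℕ → X → E} {g : X → ℝ} (hF : ∀ k, AEStronglyMeasurable (F k) μ) (hg : MemLp g p μ)
    (hFg : ∀ k, ∀ᵐ x ∂μ, ‖F k x‖ ≤ g x)
    (hlim : ∀ᵐ x ∂μ, Tendsto (fun k => F k x) atTop (𝓝 0)) :
    Tendsto (fun k => eLpNorm (F k) p μ) atTop (𝓝 0) := by
  have hr0 : 0 < p.toReal := ENNReal.toReal_pos hp0 hp'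
  have h := tendsto_lintegral_of_dominated_convergence' (μ := μ)
    (F := fun k x => ‖F k x‖ₑ ^ p.toReal) (f := fun _ => 0)
    (fun x => ‖g x‖ₑ ^ p.toReal) (fun k => (hF k).enorm.pow_const _) (fun k => by
      filter_upwards [hFg k] with x hx
      exact ENNReal.rpow_le_rpow (enorm_le_iff_norm_le.2 (hx.trans (le_abs_self _))) hr0.le)
    (lintegral_rpow_enorm_lt_top_of_eLpNorm_lt_top hp0 hp' hg.eLpNorm_lt_top).ne (by
      filter_upwards [hlim] with x hx
      have := (ENNReal.continuous_rpow_const (y := p.toReal)).tendsto _ |>.comp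
        ((continuous_enorm.tendsto _).comp hx)
      simpa [hr0, Function.comp_def] using this)
  simp only [lintegral_zero] at h
  have h2 := (ENNReal.continuous_rpow_const (y := 1 / p.toReal)).tendsto _ |>.comp h
  simp only [eLpNorm_eq_lintegral_rpow_enorm_toReal hp0 hp']
  simpa [hr0, Function.comp_def] using h2

/-- The space `X` is kept general because the result is needed on `ℝⁿ` for gradients and on `ℝⁿ ×
ℝⁿ` for difference quotients. -/
theorem tendsto_eLpNorm_sub_translate {X E : Type*} [NormedAddCommGroup X] [NormedSpace ℝ X]
    [FiniteDimensional ℝ X] [MeasurableSpace X] [BorelSpace X] [NormedAddCommGroup E]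
    {μ : Measure X} [μ.IsAddHaarMeasure] {p : ℝ≥0∞} (hp : 1 ≤ p) (hp' : p ≠ ⊤)
    {f : X → E} (hf : MemLp f p μ) :
    Tendsto (fun h : X => eLpNorm (fun z => f z - f (z - h)) p μ) (𝓝 0) (𝓝 0) := by
  have : ProperSpace X := FiniteDimensional.proper_real X
  have : Fact (1 ≤ p) := ⟨hp⟩
  -- Translations are bundled as continuous maps because continuity of composition in `L^p` is
  -- expressed in the compact-open topology.
  let g : X → C(X, X) := fun h => ⟨fun z => z - h, by fun_prop⟩
  have hg : Continuous g := by
    refine ContinuousMap.continuous_of_continuous_uncurry _ ?_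
    change Continuous fun q : X × X => q.2 - q.1
    fun_prop
  have hgm : ∀ h, MeasurePreserving (g h) μ μ := fun h => measurePreserving_sub_right μ h
  have h1 := (Filter.Tendsto.compMeasurePreservingLp (tendsto_const_nhds (x := hf.toLp f))
    (hg.tendsto 0) hgm (hgm 0) hp')
  rw [tendsto_iff_edist_tendsto_0] at h1
  refine h1.congr fun h => ?_
  rw [Lp.edist_def]
  have e : ∀ h, (Lp.compMeasurePreserving (g h) (hgm h) (hf.toLp f) : X → E) =ᵐ[μ]
      fun z => f (z - h) := by
    intro h
    filter_upwards [Lp.coeFn_compMeasurePreserving (hf.toLp f) (hgm h),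
      (hgm h).quasiMeasurePreserving.ae_eq_comp hf.coeFn_toLp] with z h1 h2
    rw [h1, h2]
    rfl
  rw [← eLpNorm_neg]
  refine eLpNorm_congr_ae ?_
  filter_upwards [e h, e 0] with z h1 h2
  simp only [Pi.neg_apply, Pi.sub_apply]
  rw [h1, h2]
  simp

/-- At each point at most one summand is nonzero, so `p`-th powers add up. The factor is `N^(1/p)`
rather than the `N` of the triangle inequality, and this gain is what makes the cut-offs cheap. -/
theorem eLpNorm_sum_le_of_disjoint {α E : Type*} [NormedAddCommGroup E] {p : ℝ≥0∞}
    [MeasurableSpace α] {μ : Measure α} (hp0 : p ≠ 0) (hp' : p ≠ ⊤) {N : ℕ} {g : ℕ → α → E} (hg : ∀ j, AEStronglyMeasurable (g j) μ)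
    (hd : ∀ i j z, g i z ≠ 0 → g j z ≠ 0 → i = j) {B : ℝ≥0∞} (hB : ∀ j, eLpNorm (g j) p μ ≤ B) :
    eLpNorm (fun z => ∑ j ∈ Finset.range N, g j z) p μ ≤ (N : ℝ≥0∞) ^ (1 / p.toReal) * B := by
  have hq : 0 < p.toReal := ENNReal.toReal_pos hp0 hp'
  have h1 : ∀ z, ‖∑ j ∈ Finset.range N, g j z‖ₑ ^ p.toReal ≤
      ∑ j ∈ Finset.range N, ‖g j z‖ₑ ^ p.toReal := by
    intro z
    by_cases h : ∃ i ∈ Finset.range N, g i z ≠ 0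
    · obtain ⟨i, hi, hiz⟩ := h
      rw [Finset.sum_eq_single i (fun j _ hji => by
        by_contra hj
        exact hji (hd j i z hj hiz)) (fun h => absurd hi h)]
      exact Finset.single_le_sum (f := fun j => ‖g j z‖ₑ ^ p.toReal) (fun _ _ => zero_le) hi
    · push Not at h
      rw [Finset.sum_eq_zero h]
      simp [hq]
  rw [eLpNorm_eq_lintegral_rpow_enorm_toReal hp0 hp', one_div, ENNReal.rpow_inv_le_iff hq,
    ENNReal.mul_rpow_of_nonneg _ _ hq.le, ENNReal.rpow_inv_rpow hq.ne']
  refine (lintegral_mono h1).trans ?_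
  rw [lintegral_finsetSum' _ fun j _ => (hg j).enorm.pow_const _]
  calc ∑ j ∈ Finset.range N, ∫⁻ z, ‖g j z‖ₑ ^ p.toReal ∂μ
      ≤ ∑ j ∈ Finset.range N, B ^ p.toReal := by
        refine Finset.sum_le_sum fun j _ => ?_
        have := hB j
        rwa [eLpNorm_eq_lintegral_rpow_enorm_toReal hp0 hp', one_div,
          ENNReal.rpow_inv_le_iff hq] at this
    _ = _ := by simp

/-! ### Dilations in `L^p` -/

/-- The dilation `z ↦ r ^ (-d / q) f (z / r)`, an isometry of `L^q` in dimension `d`. -/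
def dilate {X E : Type*} [NormedAddCommGroup X] [NormedSpace ℝ X] [NormedAddCommGroup E]
    [NormedSpace ℝ E] (q r : ℝ) (f : X → E) : X → E :=
  fun z => r ^ (-((Module.finrank ℝ X : ℝ) / q)) • f (r⁻¹ • z)

section dilate

variable {X E : Type*} [NormedAddCommGroup X] [NormedSpace ℝ X] [FiniteDimensional ℝ X]
  [MeasurableSpace X] [BorelSpace X] [NormedAddCommGroup E] [NormedSpace ℝ E]
  {μ : Measure X} [μ.IsAddHaarMeasure] {p : ℝ≥0∞}

theorem aestronglyMeasurable_dilate (q : ℝ) {r : ℝ} (hr : 0 < r) {f : X → E}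
    (hf : AEStronglyMeasurable f μ) : AEStronglyMeasurable (dilate q r f) μ :=
  (hf.comp_quasiMeasurePreserving
    (Measure.quasiMeasurePreserving_smul μ (inv_ne_zero hr.ne'))).const_smul _

theorem eLpNorm_dilate (hp0 : p ≠ 0) (hp' : p ≠ ⊤) {r : ℝ} (hr : 0 < r) {f : X → E}
    (hf : AEStronglyMeasurable f μ) : eLpNorm (dilate p.toReal r f) p μ = eLpNorm f p μ := by
  have hq : 0 < p.toReal := ENNReal.toReal_pos hp0 hp'
  have hr' : r⁻¹ ≠ 0 := inv_ne_zero hr.ne'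
  have h1 : eLpNorm (fun z => f (r⁻¹ • z)) p μ =
      ENNReal.ofReal (r ^ Module.finrank ℝ X) ^ (1 / p).toReal * eLpNorm f p μ := by
    have hm := Measure.map_addHaar_smul μ hr'
    have hf' : AEStronglyMeasurable f (Measure.map (fun z => r⁻¹ • z) μ) := by
      rw [hm]; exact hf.smul_measure _
    have := eLpNorm_map_measure (p := p) hf' (measurable_const_smul r⁻¹).aemeasurable
    rw [hm, eLpNorm_smul_measure_of_ne_top hp'] at this
    rw [Function.comp_def] at this
    rw [← this, smul_eq_mul, inv_pow, inv_inv, abs_of_pos (by positivity)]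
  have h2 : dilate p.toReal r f =
      (r ^ (-((Module.finrank ℝ X : ℝ) / p.toReal))) • (fun z => f (r⁻¹ • z)) := rfl
  rw [h2, eLpNorm_const_smul, h1, ← mul_assoc,
    Real.enorm_of_nonneg (by positivity), ENNReal.ofReal_rpow_of_nonneg (by positivity) (by simp),
    ← ENNReal.ofReal_mul (by positivity)]
  have : r ^ (-((Module.finrank ℝ X : ℝ) / p.toReal)) *
      (r ^ Module.finrank ℝ X) ^ (1 / p).toReal = 1 := by
    rw [← Real.rpow_natCast, ← Real.rpow_mul hr.le, ← Real.rpow_add hr]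
    simp [div_eq_mul_inv]
  rw [this]
  simp

/-- Averages of widely spaced dilations of an `L^p` function, `1 < p < ∞`, tend to zero. -/
theorem exists_eLpNorm_average_dilate_le [Nontrivial X] (hp : 1 < p) (hp' : p ≠ ⊤) {f : X → E}
    (hf : MemLp f p μ) (K : ℝ) {ε : ℝ≥0∞} (hε : ε ≠ 0) :
    ∃ (N : ℕ) (r : ℕ → ℝ), 0 < N ∧ (∀ j, 0 < r j ∧ K ≤ r j) ∧
      eLpNorm (fun z => (N : ℝ)⁻¹ • ∑ j ∈ Finset.range N, dilate p.toReal (r j) f z) p μ ≤ ε := by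
  have hp0 : p ≠ 0 := (one_pos.trans hp).ne'
  have hq : 0 < p.toReal := ENNReal.toReal_pos hp0 hp'
  have hq1 : 1 < p.toReal := by
    rw [← ENNReal.toReal_one]
    exact (ENNReal.toReal_lt_toReal (by simp) hp').2 hp
  have hε2 : ε / 2 ≠ 0 := by simp [hε]
  -- The function is split along an annulus. The part outside has norm at most `ε / 2`, and
  -- averaging its isometric copies does not increase that; only the part inside needs disjoint
  -- supports.
  let A : ℕ → Set X := fun m => {z | ((m : ℝ) + 1)⁻¹ ≤ ‖z‖ ∧ ‖z‖ ≤ (m : ℝ) + 1}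
  have hA : ∀ m, MeasurableSet (A m) := fun m =>
    (measurableSet_le measurable_const measurable_norm).inter
      (measurableSet_le measurable_norm measurable_const)
  obtain ⟨m, hm⟩ : ∃ m, eLpNorm ((A m)ᶜ.indicator f) p μ ≤ ε / 2 := by
    have h : Tendsto (fun m => eLpNorm ((A m)ᶜ.indicator f) p μ) atTop (𝓝 0) := by
      refine tendsto_eLpNorm_zero_of_dominated hp0 hp' (fun k => hf.1.indicator (hA k).compl)
        hf.norm (fun k => Eventually.of_forall fun x => norm_indicator_le_norm_self _ _) ?_
      -- The annuli exhaust only the complement of the origin, which is a null set because `X` is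
      -- nontrivial.
      have hne : ∀ᵐ z ∂μ, z ≠ 0 := by
        simp [ae_iff]
      filter_upwards [hne] with z hz
      refine tendsto_const_nhds.congr' ?_
      have hz' : 0 < ‖z‖ := norm_pos_iff.2 hz
      filter_upwards [(tendsto_natCast_atTop_atTop (R := ℝ)).eventually_ge_atTop
        (max ‖z‖ ‖z‖⁻¹)] with k hk
      have h1 := (le_max_left _ _).trans hk
      have h2 := (le_max_right _ _).trans hk
      rw [indicator_of_notMem]
      simp only [mem_compl_iff, not_not]
      refine ⟨?_, by linarith⟩
      rw [inv_le_comm₀ (by positivity) hz']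
      linarith
    exact ((ENNReal.tendsto_nhds_zero.1 h) _ (pos_iff_ne_zero.2 hε2)).exists
  let f₁ := (A m).indicator f
  let f₂ := (A m)ᶜ.indicator f
  have hf₁ : AEStronglyMeasurable f₁ μ := hf.1.indicator (hA m)
  have hf₂ : AEStronglyMeasurable f₂ μ := hf.1.indicator (hA m).compl
  -- The exponent `1 / p - 1` is negative exactly because `p > 1`.
  obtain ⟨N, hN0, hN⟩ : ∃ N : ℕ, 0 < N ∧
      (ENNReal.ofReal ((N : ℝ) ^ (1 / p.toReal - 1))) * eLpNorm f p μ ≤ ε / 2 := by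
    have h1 : Tendsto (fun N : ℕ => (N : ℝ) ^ (1 / p.toReal - 1)) atTop (𝓝 0) := by
      have : 0 < 1 - 1 / p.toReal := by
        rw [sub_pos, div_lt_one hq]; exact hq1
      have h := (tendsto_rpow_neg_atTop this).comp (tendsto_natCast_atTop_atTop (R := ℝ))
      simpa [Function.comp_def] using h
    have h2 : Tendsto (fun N : ℕ => (ENNReal.ofReal ((N : ℝ) ^ (1 / p.toReal - 1))) *
        eLpNorm f p μ) atTop (𝓝 0) := by
      have := ENNReal.Tendsto.mul_const (ENNReal.tendsto_ofReal h1) (b := eLpNorm f p μ)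
        (Or.inr hf.eLpNorm_lt_top.ne)
      simpa using this
    obtain ⟨N, h3, h4⟩ := ((ENNReal.tendsto_nhds_zero.1 h2 _ (pos_iff_ne_zero.2 hε2)).and
      (eventually_gt_atTop 0)).exists
    exact ⟨N, h4, h3⟩
  -- The ratio of consecutive scales exceeds `(m + 1)^2`, the ratio of the radii of the annulus, so
  -- the dilated annuli are pairwise disjoint. The prefactor `|K| + 1` below forces every scale to
  -- be at least `K`.
  let R : ℝ := ((m : ℝ) + 1) ^ 2 + 1
  have hR : 1 ≤ R := by simp only [R]; nlinarith [sq_nonneg ((m : ℝ) + 1)]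
  let r : ℕ → ℝ := fun j => (|K| + 1) * R ^ j
  have hr : ∀ j, 0 < r j := fun j => by positivity
  have hrK : ∀ j, K ≤ r j := fun j => by
    have : 1 ≤ R ^ j := one_le_pow₀ hR
    simp only [r]
    nlinarith [le_abs_self K, abs_nonneg K]
  have hrr : ∀ i j, i < j → ((m : ℝ) + 1) ^ 2 * r i < r j := fun i j hij => by
    have h1 : R ^ (i + 1) ≤ R ^ j := pow_le_pow_right₀ hR hij
    have h2 : 0 < R ^ i := by positivity
    have h3 : ((m : ℝ) + 1) ^ 2 * R ^ i < R ^ j := by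
      refine lt_of_lt_of_le ?_ h1
      rw [pow_succ' R i]
      simp only [R] at h2 ⊢
      nlinarith
    simp only [r]
    have h4 : 0 < |K| + 1 := by positivity
    nlinarith
  refine ⟨N, r, hN0, fun j => ⟨hr j, hrK j⟩, ?_⟩
  have hsplit : (fun z => (N : ℝ)⁻¹ • ∑ j ∈ Finset.range N, dilate p.toReal (r j) f z) =
      (fun z => (N : ℝ)⁻¹ • ∑ j ∈ Finset.range N, dilate p.toReal (r j) f₁ z) +
      (fun z => (N : ℝ)⁻¹ • ∑ j ∈ Finset.range N, dilate p.toReal (r j) f₂ z) := by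
    ext z
    simp only [Pi.add_apply, ← smul_add, ← Finset.sum_add_distrib, dilate]
    congr 1
    refine Finset.sum_congr rfl fun j _ => ?_
    congr 1
    exact (congrFun (indicator_self_add_compl (A m) f) _).symm
  have hm1 := fun j => aestronglyMeasurable_dilate (E := E) (μ := μ) p.toReal (hr j) hf₁
  have hm2 := fun j => aestronglyMeasurable_dilate (E := E) (μ := μ) p.toReal (hr j) hf₂
  have hs1 : AEStronglyMeasurable
      (fun z => ∑ j ∈ Finset.range N, dilate p.toReal (r j) f₁ z) μ :=
    Finset.aestronglyMeasurable_fun_sum _ fun j _ => hm1 j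
  have hs2 : AEStronglyMeasurable
      (fun z => ∑ j ∈ Finset.range N, dilate p.toReal (r j) f₂ z) μ :=
    Finset.aestronglyMeasurable_fun_sum _ fun j _ => hm2 j
  have hNr : (0 : ℝ) < N := by exact_mod_cast hN0
  rw [hsplit]
  refine (eLpNorm_add_le (hs1.const_smul _) (hs2.const_smul _) hp.le).trans ?_
  rw [← ENNReal.add_halves ε]
  refine add_le_add ?_ ?_
  · refine (eLpNorm_const_smul_le (c := (N : ℝ)⁻¹)
      (f := fun z => ∑ j ∈ Finset.range N, dilate p.toReal (r j) f₁ z)).trans ?_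
    refine le_trans ?_ hN
    refine (mul_le_mul_right (eLpNorm_sum_le_of_disjoint hp0 hp' hm1 ?_ (B := eLpNorm f p μ)
      fun j => ?_) _).trans ?_
    · intro i j z hi hj
      have key : ∀ i, dilate p.toReal (r i) f₁ z ≠ 0 →
          r i ≤ ((m : ℝ) + 1) * ‖z‖ ∧ ‖z‖ ≤ ((m : ℝ) + 1) * r i := by
        intro i hi
        have h1 : f₁ ((r i)⁻¹ • z) ≠ 0 := fun h => hi (by simp [dilate, h])
        have h2 : (r i)⁻¹ • z ∈ A m := by
          by_contra h
          exact h1 (indicator_of_notMem h _)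
        obtain ⟨h3, h4⟩ := h2
        rw [norm_smul, norm_inv, Real.norm_of_nonneg (hr i).le] at h3 h4
        have hri := hr i
        have hm0 : (0 : ℝ) < m + 1 := by positivity
        constructor
        · rw [inv_mul_eq_div, le_div_iff₀ hri, inv_mul_le_iff₀ hm0] at h3
          exact h3
        · rw [inv_mul_le_iff₀ hri] at h4
          linarith
      obtain ⟨hi1, hi2⟩ := key i hi
      obtain ⟨hj1, hj2⟩ := key j hj
      have hm0 : (0 : ℝ) < m + 1 := by positivity
      -- If `i < j` then `r j ≤ (m + 1) ‖z‖ ≤ (m + 1)^2 r i < r j`, a contradiction.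
      rcases lt_trichotomy i j with h | h | h
      · have := hrr i j h
        nlinarith [mul_le_mul_of_nonneg_left hi2 hm0.le]
      · exact h
      · have := hrr j i h
        nlinarith [mul_le_mul_of_nonneg_left hj2 hm0.le]
    · rw [eLpNorm_dilate hp0 hp' (hr j) hf₁]
      exact eLpNorm_indicator_le f
    · rw [← mul_assoc]
      gcongr
      rw [Real.enorm_of_nonneg (by positivity), ← ENNReal.ofReal_natCast,
        ENNReal.ofReal_rpow_of_nonneg (by positivity) (by positivity),
        ← ENNReal.ofReal_mul (by positivity), Real.rpow_sub hNr, Real.rpow_one]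
      apply le_of_eq
      congr 1
      field_simp
  · refine (eLpNorm_const_smul_le (c := (N : ℝ)⁻¹)
      (f := fun z => ∑ j ∈ Finset.range N, dilate p.toReal (r j) f₂ z)).trans ?_
    have h := eLpNorm_sum_le (f := fun j => dilate p.toReal (r j) f₂) (s := Finset.range N)
      (fun j _ => hm2 j) hp.le
    have h' : eLpNorm (fun z => ∑ j ∈ Finset.range N, dilate p.toReal (r j) f₂ z) p μ ≤
        N * (ε / 2) := by
      refine le_trans (le_of_eq ?_) (h.trans ?_)
      · congr 1
        ext z
        simp
      · refine (Finset.sum_le_sum fun j _ => (eLpNorm_dilate hp0 hp' (hr j) hf₂).le.trans hm).trans ?_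
        simp
    refine (mul_le_mul_right h' _).trans ?_
    rw [← mul_assoc, Real.enorm_of_nonneg (by positivity), ← ENNReal.ofReal_natCast,
      ← ENNReal.ofReal_mul (by positivity), inv_mul_cancel₀ hNr.ne']
    simp

end dilate

/-! ### Mollification -/

/-- A sequence of bump functions whose supports shrink to the origin. -/
def bump (n k : ℕ) : ContDiffBump (0 : Euc n) where
  rIn := ((k : ℝ) + 1)⁻¹ / 2
  rOut := ((k : ℝ) + 1)⁻¹
  rIn_pos := by positivity
  rIn_lt_rOut := half_lt_self (by positivity)

/-- The probability measure whose density is the normalized bump function. -/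
def bumpMeasure (n k : ℕ) : Measure (Euc n) :=
  volume.withDensity fun t => ENNReal.ofReal ((bump n k).normed volume t)

/-- The mollification of `u` by the normalized bump function. -/
def moll {n : ℕ} {E : Type*} [NormedAddCommGroup E] [NormedSpace ℝ E] (k : ℕ) (u : Euc n → E) :
    Euc n → E := fun x => ∫ t, u (x - t) ∂bumpMeasure n k


theorem locallyIntegrable_sub_left {n : ℕ} {E : Type*} [NormedAddCommGroup E]
    {u : Euc n → E} (hu : LocallyIntegrable u volume) (x : Euc n) :
    LocallyIntegrable (fun t => u (x - t)) volume := by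
  rw [locallyIntegrable_iff] at hu ⊢
  intro K hK
  have h := hu ((fun t => x - t) '' K) (hK.image (by fun_prop))
  have hmp := Measure.measurePreserving_sub_left (volume : Measure (Euc n)) x
  have he : MeasurableEmbedding (fun t : Euc n => x - t) :=
    (Homeomorph.subLeft x).measurableEmbedding
  have := (hmp.integrableOn_comp_preimage he (s := (fun t => x - t) '' K)).2 h
  rwa [preimage_image_eq _ sub_right_injective] at this

section moll

variable {n k : ℕ} {E : Type*} [NormedAddCommGroup E] [NormedSpace ℝ E]

theorem measurable_bump_density (n k : ℕ) :
    Measurable fun t => ENNReal.ofReal ((bump n k).normed volume t) :=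
  ((bump n k).continuous_normed.measurable).ennreal_ofReal

/-- Mollification is an average against a probability measure, so `eLpNorm_integral_le` applies to
it directly and constants are preserved. -/
instance (n k : ℕ) : IsProbabilityMeasure (bumpMeasure n k) := by
  constructor
  rw [bumpMeasure, withDensity_apply _ MeasurableSet.univ, Measure.restrict_univ,
    ← ofReal_integral_eq_lintegral_ofReal (bump n k).integrable_normed
      (Eventually.of_forall fun x => (bump n k).nonneg_normed x), (bump n k).integral_normed]
  simp

theorem integral_bumpMeasure (g : Euc n → E) :
    ∫ t, g t ∂bumpMeasure n k = ∫ t, (bump n k).normed volume t • g t := by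
  rw [bumpMeasure, integral_withDensity_eq_integral_toReal_smul (measurable_bump_density n k)
    (by simp)]
  simp [ENNReal.toReal_ofReal ((bump n k).nonneg_normed _)]

theorem integrable_bumpMeasure_iff {g : Euc n → E} :
    Integrable g (bumpMeasure n k) ↔
      Integrable (fun t => (bump n k).normed volume t • g t) volume := by
  rw [bumpMeasure, integrable_withDensity_iff_integrable_smul' (measurable_bump_density n k)
    (by simp)]
  simp [ENNReal.toReal_ofReal ((bump n k).nonneg_normed _)]

theorem ae_bumpMeasure_norm_lt (n k : ℕ) :
    ∀ᵐ t ∂bumpMeasure n k, ‖t‖ < ((k : ℝ) + 1)⁻¹ := by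
  rw [bumpMeasure, ae_withDensity_iff (measurable_bump_density n k)]
  refine Eventually.of_forall fun t ht => ?_
  have h : t ∈ Function.support ((bump n k).normed volume) := by
    intro h
    exact ht (by simp [h])
  rw [(bump n k).support_normed_eq] at h
  simpa [bump] using h

theorem integrable_sub_bumpMeasure {u : Euc n → E} (hu : LocallyIntegrable u volume)
    (x : Euc n) : Integrable (fun t => u (x - t)) (bumpMeasure n k) := by
  rw [integrable_bumpMeasure_iff]
  exact (locallyIntegrable_sub_left hu x).integrable_smul_left_of_hasCompactSupport
    (bump n k).continuous_normed (bump n k).hasCompactSupport_normed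

theorem moll_eq_convolution (u : Euc n → E) :
    moll k u = ((bump n k).normed volume) ⋆[ContinuousLinearMap.lsmul ℝ ℝ, volume] u := by
  ext x
  rw [moll, integral_bumpMeasure]
  rfl

theorem moll_eq_integral (u : Euc n → E) (x : Euc n) :
    moll k u x = ∫ t, (bump n k).normed volume (x - t) • u t := by
  rw [moll, integral_bumpMeasure, ← integral_sub_left_eq_self _ _ x]
  simp

theorem contDiff_moll {u : Euc n → E} (hu : LocallyIntegrable u volume) :
    ContDiff ℝ ∞ (moll k u) := by
  rw [moll_eq_convolution]
  exact (bump n k).hasCompactSupport_normed.contDiff_convolution_left _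
    (bump n k).contDiff_normed hu

theorem ae_tendsto_moll [CompleteSpace E] {u : Euc n → E} (hu : LocallyIntegrable u volume) :
    ∀ᵐ x, Tendsto (fun k => moll k u x) atTop (𝓝 (u x)) := by
  simp only [moll_eq_convolution]
  -- Convergence at Lebesgue points requires `rOut / rIn` to stay bounded; here the ratio is always
  -- `2`.
  refine ContDiffBump.ae_convolution_tendsto_right_of_locallyIntegrable (K := 2) ?_ ?_ hu
  · exact tendsto_inv_atTop_zero.comp
      (tendsto_atTop_add_const_right _ _ tendsto_natCast_atTop_atTop)
  · refine Eventually.of_forall fun i => ?_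
    simp only [bump]
    linarith

theorem isTest_bump_sub (n k : ℕ) (x : Euc n) :
    IsTest n fun t => (bump n k).normed volume (x - t) := by
  refine ⟨(bump n k).contDiff_normed.comp (contDiff_const.sub contDiff_id), ?_⟩
  exact (bump n k).hasCompactSupport_normed.comp_homeomorph (Homeomorph.subLeft x)

theorem inner_gradient {f : Euc n → ℝ} (x v : Euc n) :
    inner ℝ (gradient f x) v = fderiv ℝ f x v := by
  simp [gradient]

/-- The derivative falls on the kernel, and `t ↦ ρ(x - t)` is an admissible test function for the
weak gradient. The minus sign of the weak gradient cancels the one from differentiating in `t`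
(`h5`). -/
theorem gradient_moll {u : Euc n → ℝ} {G : Euc n → Euc n} (hu : LocallyIntegrable u volume)
    (hG : IsWeakGradient n u G) : gradient (moll k u) = moll k G := by
  ext1 x
  refine ext_inner_right ℝ fun v => ?_
  have hρ : ContDiff ℝ 1 ((bump n k).normed (volume : Measure (Euc n))) :=
    (bump n k).contDiff_normed
  have hρc : HasCompactSupport ((bump n k).normed (volume : Measure (Euc n))) :=
    (bump n k).hasCompactSupport_normed
  have h1 : moll k u =
      u ⋆[ContinuousLinearMap.mul ℝ ℝ, volume] ((bump n k).normed volume) := by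
    ext y
    rw [moll_eq_integral]
    simp [convolution_def, mul_comm]
  have h2 := hρc.hasFDerivAt_convolution_right (ContinuousLinearMap.mul ℝ ℝ) hu hρ x
  have h3 := (isTest_bump_sub n k x)
  have h4 := hG.2 _ h3 v
  have h5 : ∀ t, fderiv ℝ (fun t => (bump n k).normed volume (x - t)) t v =
      - fderiv ℝ ((bump n k).normed volume) (x - t) v := by
    intro t
    have := ((hρ.differentiable one_ne_zero (x - t)).hasFDerivAt.comp t
      ((hasFDerivAt_const x t).sub (hasFDerivAt_id t))).fderiv
    rw [Function.comp_def] at this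
    rw [this]
    simp
  rw [inner_gradient, h1, h2.fderiv,
    convolution_precompR_apply _ hu (hρc.fderiv (𝕜 := ℝ)) (hρ.continuous_fderiv one_ne_zero)]
  simp only [h5, mul_neg, integral_neg, neg_inj] at h4
  rw [convolution_def]
  simp only [ContinuousLinearMap.mul_apply']
  rw [h4, moll_eq_integral, real_inner_comm, ← integral_inner]
  · simp [inner_smul_right, mul_comm, real_inner_comm]
  · exact hG.1.integrable_smul_left_of_hasCompactSupport h3.1.continuous h3.2

/-- The map `a` covers two cases: `a = id` for gradients, and `a t = (t, t)` for difference
quotients, where mollifying `u` amounts to averaging over diagonal translations. -/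
theorem eLpNorm_integral_translate_sub {X : Type*} [NormedAddCommGroup X] [NormedSpace ℝ X]
    [FiniteDimensional ℝ X] [MeasurableSpace X] [BorelSpace X] {μ : Measure X}
    [μ.IsAddHaarMeasure] {p : ℝ≥0∞} (hp : 1 ≤ p) (hp' : p ≠ ⊤) {f : X → E}
    (hfm : StronglyMeasurable f) (hf : MemLp f p μ) {a : Euc n → X} (ha : Continuous a)
    (ha0 : a 0 = 0) :
    Tendsto (fun k => eLpNorm (fun z => ∫ t, (f z - f (z - a t)) ∂bumpMeasure n k) p μ) atTop
      (𝓝 0) := by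
  have h1 : Tendsto (fun t => eLpNorm (fun z => f z - f (z - a t)) p μ) (𝓝 0) (𝓝 0) :=
    (tendsto_eLpNorm_sub_translate hp hp' hf).comp (ha0 ▸ ha.tendsto 0)
  rw [ENNReal.tendsto_nhds_zero] at h1 ⊢
  intro ε hε
  obtain ⟨δ, hδ, h2⟩ := Metric.eventually_nhds_iff.1 (h1 ε hε)
  have h3 : Tendsto (fun k : ℕ => ((k : ℝ) + 1)⁻¹) atTop (𝓝 0) :=
    tendsto_inv_atTop_zero.comp (tendsto_atTop_add_const_right _ _ tendsto_natCast_atTop_atTop)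
  filter_upwards [h3.eventually_lt_const hδ] with k hk
  refine eLpNorm_integral_le (F := fun t z => f z - f (z - a t)) ?_ hp hp' ?_
  · have : SecondCountableTopology X := by
      have := FiniteDimensional.proper_real X
      infer_instance
    refine StronglyMeasurable.aestronglyMeasurable ?_
    refine (hfm.comp_measurable measurable_snd).sub (hfm.comp_measurable ?_)
    exact measurable_snd.sub (ha.measurable.comp measurable_fst)
  · filter_upwards [ae_bumpMeasure_norm_lt n k] with t ht
    exact h2 (by simpa using ht.trans hk)

theorem eLpNorm_moll_le {p : ℝ≥0∞} (hp : 1 ≤ p) (hp' : p ≠ ⊤) {f : Euc n → E}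
    (hf : AEStronglyMeasurable f volume) : eLpNorm (moll k f) p volume ≤ eLpNorm f p volume := by
  refine eLpNorm_integral_le (F := fun t z => f (z - t)) ?_ hp hp' (Eventually.of_forall fun t => ?_)
  · have hac : bumpMeasure n k ≪ volume := withDensity_absolutelyContinuous _ _
    have h : AEStronglyMeasurable (fun q : Euc n × Euc n => f (q.2 - q.1)) (volume.prod volume) :=
      hf.comp_quasiMeasurePreserving
        ((quasiMeasurePreserving_sub volume volume).comp Measure.measurePreserving_swap.quasiMeasurePreserving)
    exact h.mono_ac (hac.prod Measure.AbsolutelyContinuous.rfl)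
  · exact (eLpNorm_comp_measurePreserving hf (measurePreserving_sub_right volume t)).le

end moll

/-! ### The seminorm as an `L^p` norm -/

/-- The difference quotient whose `L^p` norm is the Gagliardo-Slobodeckii seminorm. -/
def diffQuot (n : ℕ) (s p : ℝ) (u : Euc n → ℝ) : Euc n × Euc n → ℝ :=
  fun z => ‖z.1 - z.2‖ ^ (-(((n : ℝ) + s * p) / p)) * (u z.1 - u z.2)

section diffQuot

variable {n : ℕ} {s p : ℝ}

theorem eLpNorm_diffQuot (hp : 1 ≤ p) (u : Euc n → ℝ) :
    eLpNorm (diffQuot n s p u) (ENNReal.ofReal p) volume =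
      gagliardoIntegral n s p u ^ (1 / p) := by
  have hp0 : 0 < p := by linarith
  rw [eLpNorm_eq_lintegral_rpow_enorm_toReal (by simpa using hp0) (by simp),
    ENNReal.toReal_ofReal hp0.le, gagliardoIntegral_eq hp]
  congr 1
  refine lintegral_congr fun z => ?_
  congr 1
  rw [diffQuot, enorm_mul]
  -- On the diagonal the real weight and the extended one may have different default values, but the
  -- factor `u z.1 - u z.2` vanishes.
  rcases eq_or_ne z.1 z.2 with h | h
  · simp [h]
  have hz : 0 < ‖z.1 - z.2‖ := norm_pos_iff.2 (sub_ne_zero.2 h)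
  rw [mul_comm, Real.enorm_of_nonneg (Real.rpow_nonneg (norm_nonneg _) _), ← ofReal_norm (z.1 - z.2),
    ENNReal.ofReal_rpow_of_pos hz, ← ENNReal.ofReal_inv_of_pos (by positivity),
    ENNReal.ofReal_rpow_of_pos (by positivity), ← Real.rpow_neg hz.le, ← Real.rpow_mul hz.le]
  congr 3
  ring

theorem gagliardo_eq_eLpNorm (hp : 1 ≤ p) (hs : s ≠ 1) (u : Euc n → ℝ) :
    gagliardo n s p u = ENNReal.ofReal (s * (1 - s)) ^ (1 / p) *
      eLpNorm (diffQuot n s p u) (ENNReal.ofReal p) volume := by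
  have hp0 : 0 < p := by linarith
  rw [gagliardo, if_neg hs, eLpNorm_diffQuot hp, ENNReal.mul_rpow_of_nonneg _ _ (by positivity)]

theorem eLpNorm_diffQuot_lt_top (hp : 1 ≤ p) (hs0 : 0 < s) (hs1 : s < 1) {u : Euc n → ℝ}
    (hu : gagliardo n s p u < ⊤) :
    eLpNorm (diffQuot n s p u) (ENNReal.ofReal p) volume < ⊤ := by
  have hp0 : 0 < p := by linarith
  rw [gagliardo_eq_eLpNorm hp hs1.ne] at hu
  by_contra h
  rw [not_lt_top_iff] at h
  rw [h, ENNReal.mul_top] at hu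
  · exact lt_irrefl _ hu
  · have : 0 < s * (1 - s) := mul_pos hs0 (by linarith)
    simp [ENNReal.rpow_eq_zero_iff, this]

theorem tendsto_gagliardo_of_diffQuot {ι : Type*} {l : Filter ι} (hp : 1 ≤ p) (hs : s ≠ 1)
    {u : ι → Euc n → ℝ}
    (h : Tendsto (fun i => eLpNorm (diffQuot n s p (u i)) (ENNReal.ofReal p) volume) l (𝓝 0)) :
    Tendsto (fun i => gagliardo n s p (u i)) l (𝓝 0) := by
  simp only [gagliardo_eq_eLpNorm hp hs]
  have := ENNReal.Tendsto.const_mul (a := ENNReal.ofReal (s * (1 - s)) ^ (1 / p)) h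
    (Or.inr (ENNReal.rpow_ne_top_of_nonneg (by positivity) (by simp)))
  simpa using this

theorem aestronglyMeasurable_diffQuot {u : Euc n → ℝ} (hu : AEStronglyMeasurable u volume) :
    AEStronglyMeasurable (diffQuot n s p u) volume := by
  have h1 : AEStronglyMeasurable (fun z : Euc n × Euc n => u z.1 - u z.2) volume :=
    (hu.comp_quasiMeasurePreserving Measure.quasiMeasurePreserving_fst).sub
      (hu.comp_quasiMeasurePreserving Measure.quasiMeasurePreserving_snd)
  refine AEStronglyMeasurable.mul (Measurable.aestronglyMeasurable ?_) h1
  fun_prop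

theorem stronglyMeasurable_diffQuot {u : Euc n → ℝ} (hu : StronglyMeasurable u) :
    StronglyMeasurable (diffQuot n s p u) := by
  refine StronglyMeasurable.mul (Measurable.stronglyMeasurable ?_)
    ((hu.comp_measurable measurable_fst).sub (hu.comp_measurable measurable_snd))
  fun_prop

end diffQuot

/-! ### Uniqueness and stability of weak gradients -/

section weakGradient

variable {n : ℕ} {p : ℝ}

/-- The fundamental lemma of the calculus of variations, applied after pairing with a fixed vector.
It lets the infimum in `gradNorm` be evaluated at any weak gradient. -/
theorem IsWeakGradient.ae_eq {u : Euc n → ℝ} {G H : Euc n → Euc n} (hG : IsWeakGradient n u G)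
    (hH : IsWeakGradient n u H) : G =ᵐ[volume] H := by
  refine ae_eq_of_integral_contDiff_smul_eq hG.1 hH.1 fun φ hφ hc => ?_
  have hi : ∀ {G : Euc n → Euc n}, LocallyIntegrable G volume → Integrable (fun x => φ x • G x) :=
    fun h => h.integrable_smul_left_of_hasCompactSupport hφ.continuous hc
  refine ext_inner_right ℝ fun v => ?_
  rw [real_inner_comm, ← integral_inner (hi hG.1), real_inner_comm, ← integral_inner (hi hH.1)]
  have h := (hG.2 φ ⟨hφ, hc⟩ v).symm.trans (hH.2 φ ⟨hφ, hc⟩ v)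
  rw [neg_inj] at h
  simpa [inner_smul_right, mul_comm, real_inner_comm] using h

theorem IsWeakGradient.gradNorm_eq {u : Euc n → ℝ} {G : Euc n → Euc n}
    (hG : IsWeakGradient n u G) : gradNorm n p u = eLpNorm G (ENNReal.ofReal p) volume := by
  refine le_antisymm (iInf₂_le G hG) (le_iInf₂ fun H hH => ?_)
  exact (eLpNorm_congr_ae (hG.ae_eq hH)).le

theorem exists_isWeakGradient {u : Euc n → ℝ} (hu : gagliardo n 1 p u < ⊤) :
    ∃ G, IsWeakGradient n u G ∧ MemLp G (ENNReal.ofReal p) volume := by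
  rw [gagliardo, if_pos rfl, gradNorm, iInf_lt_iff] at hu
  obtain ⟨G, hu⟩ := hu
  obtain ⟨hG, h⟩ := iInf_lt_iff.1 hu
  exact ⟨G, hG, hG.1.aestronglyMeasurable, h⟩

theorem IsWeakGradient.gagliardo_eq {u : Euc n → ℝ} {G : Euc n → Euc n}
    (hG : IsWeakGradient n u G) : gagliardo n 1 p u = eLpNorm G (ENNReal.ofReal p) volume := by
  rw [gagliardo, if_pos rfl, hG.gradNorm_eq]

theorem IsWeakGradient.sub {u v : Euc n → ℝ} {G H : Euc n → Euc n}
    (hu' : LocallyIntegrable u volume) (hv' : LocallyIntegrable v volume)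
    (hu : IsWeakGradient n u G) (hv : IsWeakGradient n v H) :
    IsWeakGradient n (u - v) (G - H) := by
  have := hu.add hu' (hv'.smul (-1)) (hv.smul (-1))
  simpa [sub_eq_add_neg] using this

theorem continuous_gradient {v : Euc n → ℝ} (hv : ContDiff ℝ ∞ v) : Continuous (gradient v) := by
  unfold gradient
  exact (LinearIsometryEquiv.continuous _).comp (hv.continuous_fderiv (by simp))

theorem isWeakGradient_gradient {v : Euc n → ℝ} (hv : ContDiff ℝ ∞ v) :
    IsWeakGradient n v (gradient v) := by
  refine ⟨(continuous_gradient hv).locallyIntegrable, fun ψ hψ w => ?_⟩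
  simp only [inner_gradient]
  have hc : Continuous fun x => fderiv ℝ v x w :=
    (hv.continuous_fderiv (by simp)).clm_apply continuous_const
  refine integral_mul_fderiv_eq_neg_fderiv_mul_of_integrable ?_ ?_ ?_
    (fun x _ => hv.differentiable (by simp) x) (fun x _ => hψ.1.differentiable (by simp) x)
  · exact integrable_mul_test hc.locallyIntegrable hψ.1.continuous hψ.2
  · exact integrable_mul_test hv.continuous.locallyIntegrable (hψ.continuous_fderiv w)
      (hψ.compact_fderiv w)
  · exact integrable_mul_test hv.continuous.locallyIntegrable hψ.1.continuous hψ.2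

end weakGradient

/-! ### The Poincaré inequality -/

section translation

variable {n : ℕ} {p : ℝ≥0∞}

/-- The increment is the average over `t ∈ (0, 1]` of `⟨∇v(x - t h), h⟩`; Minkowski and translation
invariance conclude. -/
theorem eLpNorm_sub_translate_le_gradient (hp : 1 ≤ p) (hp' : p ≠ ⊤) {v : Euc n → ℝ}
    (hv : ContDiff ℝ ∞ v) (h : Euc n) :
    eLpNorm (fun x => v x - v (x - h)) p volume ≤ ‖h‖ₑ * eLpNorm (gradient v) p volume := by
  have hg := continuous_gradient hv
  have hftc : ∀ x, v x - v (x - h) =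
      ∫ t, inner ℝ (gradient v (x - t • h)) h ∂(volume.restrict (Ioc (0 : ℝ) 1)) := by
    intro x
    have hd : ∀ t ∈ uIcc (0 : ℝ) 1, HasDerivAt (fun t : ℝ => -v (x - t • h))
        (inner ℝ (gradient v (x - t • h)) h) t := by
      intro t _
      have h1 : HasDerivAt (fun t : ℝ => x - t • h) (-h) t := by
        simpa using ((hasDerivAt_id t).smul_const h).const_sub x
      have h2 := (hv.differentiable (by simp) (x - t • h)).hasFDerivAt.comp_hasDerivAt t h1
      have h3 := h2.neg
      rw [map_neg, neg_neg, ← inner_gradient] at h3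
      exact h3
    have hi := intervalIntegral.integral_eq_sub_of_hasDerivAt hd
      (Continuous.intervalIntegrable (by fun_prop) _ _)
    rw [intervalIntegral.integral_of_le zero_le_one] at hi
    rw [hi]
    simp
    ring
  simp only [hftc]
  have : IsProbabilityMeasure (volume.restrict (Ioc (0 : ℝ) 1)) := ⟨by simp⟩
  refine eLpNorm_integral_le (F := fun t x => inner ℝ (gradient v (x - t • h)) h) ?_ hp hp'
    (Eventually.of_forall fun t => ?_)
  · refine Continuous.aestronglyMeasurable ?_
    unfold Function.uncurry
    fun_prop
  · have h1 : eLpNorm (fun x => gradient v (x - t • h)) p volume = eLpNorm (gradient v) p volume :=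
      eLpNorm_comp_measurePreserving hg.aestronglyMeasurable
        (measurePreserving_sub_right volume (t • h))
    rw [← h1]
    refine eLpNorm_le_nnreal_smul_eLpNorm_of_ae_le_mul (c := ‖h‖₊)
      (Eventually.of_forall fun x => ?_) p
    rw [mul_comm]
    exact nnnorm_inner_le_nnnorm (𝕜 := ℝ) _ _

/-- The smooth case applies to the mollifications, whose gradients have norm at most that of `G`.
The bound survives the almost everywhere limit by Fatou. -/
theorem eLpNorm_sub_translate_le (hp : 1 ≤ p) (hp' : p ≠ ⊤) {u : Euc n → ℝ} {G : Euc n → Euc n}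
    (hu : LocallyIntegrable u volume) (hG : IsWeakGradient n u G) (h : Euc n) :
    eLpNorm (fun x => u x - u (x - h)) p volume ≤ ‖h‖ₑ * eLpNorm G p volume := by
  have hmp := measurePreserving_sub_right (volume : Measure (Euc n)) h
  have hlim := ae_tendsto_moll hu
  refine Lp.eLpNorm_le_of_ae_tendsto (u := atTop)
    (f := fun (k : ℕ) x => moll k u x - moll k u (x - h)) (Eventually.of_forall fun k => ?_)
    (fun k => ?_) ?_
  · refine (eLpNorm_sub_translate_le_gradient hp hp' (contDiff_moll hu) h).trans ?_
    rw [gradient_moll hu hG]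
    gcongr
    exact eLpNorm_moll_le hp hp' hG.1.aestronglyMeasurable
  · have := (contDiff_moll (k := k) hu).continuous
    exact Continuous.aestronglyMeasurable (by fun_prop)
  · filter_upwards [hlim, hmp.quasiMeasurePreserving.ae hlim] with x h1 h2
    exact h1.sub h2

end translation

section poincare

variable {n : ℕ} {s p : ℝ}

/-- Two points of the ball are at distance at most `2ρ`, and `n + s p = 2n`, so the kernel is at
least `(2ρ)^(-2n)` there. -/
theorem lintegral_ball_prod_le_fractional (hp : 1 ≤ p) (hs0 : 0 < s) (hs1 : s < 1)
    (hsp : s * p = n) (u : Euc n → ℝ) (x₀ : Euc n) (ρ : ℝ) :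
    ∫⁻ z in ball x₀ ρ ×ˢ ball x₀ ρ, ‖u z.1 - u z.2‖ₑ ^ p ≤
      (ENNReal.ofReal (2 ^ (2 * n)) * (ENNReal.ofReal (s * (1 - s)))⁻¹) *
        ENNReal.ofReal (ρ ^ (2 * n)) * gagliardo n s p u ^ p := by
  have hp0 : 0 < p := by linarith
  have hc : 0 < s * (1 - s) := mul_pos hs0 (by linarith)
  have h1 : ∀ z ∈ ball x₀ ρ ×ˢ ball x₀ ρ, ‖u z.1 - u z.2‖ₑ ^ p ≤
      ENNReal.ofReal ((2 * ρ) ^ (2 * n)) *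
        (‖u z.1 - u z.2‖ₑ ^ p / ‖z.1 - z.2‖ₑ ^ ((n : ℝ) + s * p)) := by
    rintro z ⟨hz1, hz2⟩
    rcases eq_or_ne z.1 z.2 with h | h
    · simp [h, hp0]
    have hz : 0 < ‖z.1 - z.2‖ := norm_pos_iff.2 (sub_ne_zero.2 h)
    have hd : ‖z.1 - z.2‖ ≤ 2 * ρ := by
      rw [← dist_eq_norm]
      have := dist_triangle_right z.1 z.2 x₀
      rw [mem_ball] at hz1 hz2
      linarith
    rw [← mul_div_assoc, ENNReal.le_div_iff_mul_le, mul_comm]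
    · gcongr
      rw [← ofReal_norm, ENNReal.ofReal_rpow_of_pos hz]
      refine ENNReal.ofReal_le_ofReal ?_
      rw [hsp, show (n : ℝ) + n = ((2 * n : ℕ) : ℝ) by push_cast; ring, Real.rpow_natCast]
      gcongr
    · left
      rw [← ofReal_norm, ENNReal.ofReal_rpow_of_pos hz]
      simp only [ne_eq, ENNReal.ofReal_eq_zero, not_le]
      positivity
    · left
      rw [← ofReal_norm, ENNReal.ofReal_rpow_of_pos hz]
      exact ENNReal.ofReal_ne_top
  have h2 : gagliardo n s p u ^ p = ENNReal.ofReal (s * (1 - s)) * gagliardoIntegral n s p u := by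
    rw [gagliardo, if_neg hs1.ne, ← ENNReal.rpow_mul, one_div_mul_cancel hp0.ne', ENNReal.rpow_one]
  calc ∫⁻ z in ball x₀ ρ ×ˢ ball x₀ ρ, ‖u z.1 - u z.2‖ₑ ^ p
      ≤ ∫⁻ z in ball x₀ ρ ×ˢ ball x₀ ρ, ENNReal.ofReal ((2 * ρ) ^ (2 * n)) *
        (‖u z.1 - u z.2‖ₑ ^ p / ‖z.1 - z.2‖ₑ ^ ((n : ℝ) + s * p)) :=
        setLIntegral_mono' (measurableSet_ball.prod measurableSet_ball) h1
    _ ≤ ENNReal.ofReal ((2 * ρ) ^ (2 * n)) * gagliardoIntegral n s p u := by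
        rw [lintegral_const_mul' _ _ (by simp)]
        gcongr
        exact setLIntegral_le_lintegral _ _
    _ = _ := by
        rw [h2, mul_pow, ENNReal.ofReal_mul (by positivity)]
        rw [show ∀ a b c d e : ℝ≥0∞, a * b * c * (d * e) = a * c * (b * d) * e by
          intros; ring, ENNReal.inv_mul_cancel (by simpa using hc) (by simp), mul_one]

/-- With `h = x - y`, the translation estimate bounds the integral in `x` by `|h|^n ‖G‖^p`, as `p =
n`. Integrating over `|h| < 2ρ` supplies the second factor `ρ^n`. -/
theorem lintegral_ball_prod_le_gradient (hp : 1 ≤ p) (hn : p = n) {u : Euc n → ℝ}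
    (hu : MemLpLoc n p u) {G : Euc n → Euc n} (hG : IsWeakGradient n u G) (x₀ : Euc n) {ρ : ℝ}
    (hρ : 0 < ρ) :
    ∫⁻ z in ball x₀ ρ ×ˢ ball x₀ ρ, ‖u z.1 - u z.2‖ₑ ^ p ≤
      (ENNReal.ofReal (2 ^ (2 * n)) * volume (ball (0 : Euc n) 1)) *
        ENNReal.ofReal (ρ ^ (2 * n)) * eLpNorm G (ENNReal.ofReal p) volume ^ p := by
  have hp0 : 0 < p := by linarith
  have hu' := hu.locallyIntegrable hp
  have hpe : 1 ≤ ENNReal.ofReal p := by simpa using hp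
  have hpne : ENNReal.ofReal p ≠ 0 := by simpa using hp0
  -- Only `|x - y| < 2ρ` is retained from the restriction to the two balls, so the integral in `x`
  -- can run over the whole space.
  let χ : Euc n → ℝ≥0∞ := (ball 0 (2 * ρ)).indicator 1
  have hχ : Measurable χ := measurable_one.indicator measurableSet_ball
  have hm : AEMeasurable (fun z : Euc n × Euc n => χ z.2 * ‖u z.1 - u (z.1 - z.2)‖ₑ ^ p)
      (volume.prod volume) := by
    refine (hχ.comp measurable_snd).aemeasurable.mul (AEMeasurable.pow_const ?_ _)
    refine AEStronglyMeasurable.enorm (AEStronglyMeasurable.sub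
      (hu.1.comp_quasiMeasurePreserving Measure.quasiMeasurePreserving_fst)
      (hu.1.comp_quasiMeasurePreserving ?_))
    exact quasiMeasurePreserving_sub volume volume
  have hm' : AEMeasurable (fun z : Euc n × Euc n => χ (z.1 - z.2) * ‖u z.1 - u z.2‖ₑ ^ p)
      (volume.prod volume) := by
    refine (hχ.comp (measurable_fst.sub measurable_snd)).aemeasurable.mul
      (AEMeasurable.pow_const ?_ _)
    exact AEStronglyMeasurable.enorm (AEStronglyMeasurable.sub
      (hu.1.comp_quasiMeasurePreserving Measure.quasiMeasurePreserving_fst)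
      (hu.1.comp_quasiMeasurePreserving Measure.quasiMeasurePreserving_snd))
  have h1 : ∫⁻ z in ball x₀ ρ ×ˢ ball x₀ ρ, ‖u z.1 - u z.2‖ₑ ^ p ≤
      ∫⁻ z : Euc n × Euc n, χ (z.1 - z.2) * ‖u z.1 - u z.2‖ₑ ^ p ∂(volume.prod volume) := by
    refine le_trans (setLIntegral_mono' (measurableSet_ball.prod measurableSet_ball) ?_)
      (setLIntegral_le_lintegral (ball x₀ ρ ×ˢ ball x₀ ρ) _)
    rintro z ⟨hz1, hz2⟩
    have : z.1 - z.2 ∈ ball (0 : Euc n) (2 * ρ) := by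
      rw [mem_ball_zero_iff, ← dist_eq_norm]
      have := dist_triangle_right z.1 z.2 x₀
      rw [mem_ball] at hz1 hz2
      linarith
    simp [χ, this]
  have h2 : ∫⁻ z : Euc n × Euc n, χ (z.1 - z.2) * ‖u z.1 - u z.2‖ₑ ^ p ∂(volume.prod volume) =
      ∫⁻ h, χ h * ∫⁻ x, ‖u x - u (x - h)‖ₑ ^ p := by
    rw [lintegral_prod _ hm']
    have : ∀ x : Euc n, ∫⁻ y, χ (x - y) * ‖u x - u y‖ₑ ^ p =
        ∫⁻ h, χ h * ‖u x - u (x - h)‖ₑ ^ p := by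
      intro x
      rw [← lintegral_sub_left_eq_self (fun h => χ h * ‖u x - u (x - h)‖ₑ ^ p) x]
      simp
    simp only [this]
    rw [lintegral_lintegral_swap hm]
    refine lintegral_congr fun h => ?_
    rw [lintegral_const_mul']
    simp only [χ, indicator]
    split_ifs <;> simp
  have h3 : ∀ h, χ h * ∫⁻ x, ‖u x - u (x - h)‖ₑ ^ p ≤
      χ h * (ENNReal.ofReal ((2 * ρ) ^ n) * eLpNorm G (ENNReal.ofReal p) volume ^ p) := by
    intro h
    by_cases hh : h ∈ ball (0 : Euc n) (2 * ρ)
    · gcongr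
      have h4 := eLpNorm_sub_translate_le hpe (by simp) hu' hG h
      rw [eLpNorm_eq_lintegral_rpow_enorm_toReal hpne (by simp), ENNReal.toReal_ofReal hp0.le,
        one_div, ENNReal.rpow_inv_le_iff hp0, ENNReal.mul_rpow_of_nonneg _ _ hp0.le] at h4
      refine h4.trans ?_
      gcongr
      rw [← ofReal_norm, ENNReal.ofReal_rpow_of_nonneg (norm_nonneg _) hp0.le, hn,
        Real.rpow_natCast]
      rw [mem_ball_zero_iff] at hh
      gcongr
    · simp [χ, hh]
  rw [h2] at h1
  refine h1.trans ((lintegral_mono h3).trans ?_)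
  rw [lintegral_mul_const _ hχ, lintegral_indicator_one measurableSet_ball,
    Measure.addHaar_ball_of_pos _ _ (by positivity), finrank_euclideanSpace, Fintype.card_fin,
    two_mul n, pow_add, pow_add, mul_pow]
  apply le_of_eq
  simp only [ENNReal.ofReal_mul (show (0 : ℝ) ≤ 2 ^ n by positivity),
    ENNReal.ofReal_mul (show (0 : ℝ) ≤ ρ ^ n by positivity)]
  ring

theorem exists_lintegral_ball_prod_le (hs0 : 0 < s) (hs1 : s ≤ 1) (hp : 1 ≤ p)
    (hsp : s * p = n) :
    ∃ C : ℝ≥0∞, C ≠ ⊤ ∧ ∀ u : Euc n → ℝ, MemLpLoc n p u → gagliardo n s p u < ⊤ →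
      ∀ (x₀ : Euc n) (ρ : ℝ), 0 < ρ →
      ∫⁻ z in ball x₀ ρ ×ˢ ball x₀ ρ, ‖u z.1 - u z.2‖ₑ ^ p ≤
        C * ENNReal.ofReal (ρ ^ (2 * n)) * gagliardo n s p u ^ p := by
  rcases hs1.lt_or_eq with h | rfl
  · refine ⟨_, ?_, fun u _ _ x₀ ρ _ => lintegral_ball_prod_le_fractional hp hs0 h hsp u x₀ ρ⟩
    refine ENNReal.mul_ne_top (by simp) (ENNReal.inv_ne_top.2 ?_)
    have : 0 < s * (1 - s) := mul_pos hs0 (by linarith)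
    simpa using this
  · refine ⟨ENNReal.ofReal (2 ^ (2 * n)) * volume (ball (0 : Euc n) 1),
      ENNReal.mul_ne_top (by simp) measure_ball_lt_top.ne, fun u hu hu' x₀ ρ hρ => ?_⟩
    obtain ⟨G, hG, -⟩ := exists_isWeakGradient hu'
    rw [hG.gagliardo_eq]
    exact lintegral_ball_prod_le_gradient hp (by linarith) hu hG x₀ hρ

/-- Jensen's inequality for the normalized restriction of `μ` to `A`. -/
theorem enorm_sub_setAverage_rpow_le {α : Type*} [MeasurableSpace α] {μ : Measure α} {A : Set α}
    (hA0 : μ A ≠ 0) (hA : μ A ≠ ⊤) (hp : 1 ≤ p) {u : α → ℝ} (hu : IntegrableOn u A μ) (a : ℝ) :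
    ‖a - ⨍ y in A, u y ∂μ‖ₑ ^ p ≤ (μ A)⁻¹ * ∫⁻ y in A, ‖a - u y‖ₑ ^ p ∂μ := by
  have hp0 : 0 < p := by linarith
  have : IsFiniteMeasure (μ.restrict A) := ⟨by simpa using hA.lt_top⟩
  have : NeZero (μ.restrict A) := ⟨by simpa using hA0⟩
  have h1 : a - ⨍ y in A, u y ∂μ = ∫ y, (a - u y) ∂((μ.restrict A univ)⁻¹ • μ.restrict A) := by
    rw [average, integral_sub (integrable_const a), integral_const, probReal_univ, one_smul]
    · exact hu.integrable.smul_measure (ENNReal.inv_ne_top.2 (by simpa using hA0))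
  have hm : AEStronglyMeasurable (fun y => a - u y) ((μ.restrict A univ)⁻¹ • μ.restrict A) :=
    (aestronglyMeasurable_const.sub hu.aestronglyMeasurable).smul_measure _
  have h := eLpNorm'_le_eLpNorm'_of_exponent_le
    (μ := (μ.restrict A univ)⁻¹ • μ.restrict A) one_pos hp hm
  rw [eLpNorm'_eq_lintegral_enorm, eLpNorm'_eq_lintegral_enorm] at h
  simp only [ENNReal.rpow_one, div_one] at h
  rw [h1, ← ENNReal.le_rpow_inv_iff hp0, ← one_div p]
  refine (enorm_integral_le_lintegral_enorm _).trans (h.trans (le_of_eq ?_))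
  rw [lintegral_smul_measure, Measure.restrict_apply_univ, smul_eq_mul]

theorem MemLpLoc.integrableOn_ball (hp : 1 ≤ p) {u : Euc n → ℝ} (hu : MemLpLoc n p u)
    (x₀ : Euc n) (ρ : ℝ) : IntegrableOn u (ball x₀ ρ) volume :=
  ((hu.locallyIntegrable hp).integrableOn_isCompact (isCompact_closedBall x₀ ρ)).mono_set
    ball_subset_closedBall

/-- The averaging ball may be smaller than the ball of integration: equal balls give the Campanato
bound, and the unit ball inside a large one controls functions with zero mean on the unit ball. -/
theorem lintegral_ball_sub_average_le (hp : 1 ≤ p) {u : Euc n → ℝ} (hu : MemLpLoc n p u)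
    {x₀ y₀ : Euc n} {ρ r : ℝ} (hr : 0 < r) (hrρ : ball y₀ r ⊆ ball x₀ ρ) :
    ∫⁻ x in ball x₀ ρ, ‖u x - ⨍ y in ball y₀ r, u y‖ₑ ^ p ≤
      (volume (ball y₀ r))⁻¹ *
        ∫⁻ z in ball x₀ ρ ×ˢ ball x₀ ρ, ‖u z.1 - u z.2‖ₑ ^ p := by
  have h0 : volume (ball y₀ r) ≠ 0 := (measure_ball_pos _ _ hr).ne'
  have hm : AEMeasurable (fun z : Euc n × Euc n => ‖u z.1 - u z.2‖ₑ ^ p)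
      ((volume.restrict (ball x₀ ρ)).prod (volume.restrict (ball x₀ ρ))) := by
    refine (AEStronglyMeasurable.enorm (AEStronglyMeasurable.sub
      (hu.1.restrict.comp_quasiMeasurePreserving Measure.quasiMeasurePreserving_fst)
      (hu.1.restrict.comp_quasiMeasurePreserving Measure.quasiMeasurePreserving_snd))).pow_const _
  rw [Measure.volume_eq_prod, ← Measure.prod_restrict, lintegral_prod _ hm,
    ← lintegral_const_mul' _ _ (ENNReal.inv_ne_top.2 h0)]
  refine lintegral_mono fun x => ?_
  refine (enorm_sub_setAverage_rpow_le h0 measure_ball_lt_top.ne hp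
    (hu.integrableOn_ball hp y₀ r) (u x)).trans ?_
  gcongr

/-- The powers of the radius cancel: `ρ^(-n)` from the Campanato weight, `ρ^(-n)` from the mean,
`ρ^(2n)` from the Poincaré inequality. Membership in `preW` thus reduces to a finite seminorm and
`L^p_loc`. -/
theorem campanato_lt_top (hs0 : 0 < s) (hs1 : s ≤ 1) (hp : 1 ≤ p) (hsp : s * p = n)
    {u : Euc n → ℝ} (hu : MemLpLoc n p u) (hu' : gagliardo n s p u < ⊤) :
    campanato n p n u < ⊤ := by
  have hp0 : 0 < p := by linarith
  obtain ⟨C, hC, h⟩ := exists_lintegral_ball_prod_le hs0 hs1 hp hsp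
  have hB0 : volume (ball (0 : Euc n) 1) ≠ 0 := (measure_ball_pos _ _ one_pos).ne'
  refine lt_of_le_of_lt (b := ((volume (ball (0 : Euc n) 1))⁻¹ * C *
    gagliardo n s p u ^ p) ^ (1 / p)) ?_ ?_
  · refine iSup_le fun x₀ => iSup₂_le fun ρ hρ => ?_
    have h1 := (lintegral_ball_sub_average_le hp hu hρ (subset_refl (ball x₀ ρ))).trans
      (mul_le_mul_right (h u hu hu' x₀ ρ hρ) _)
    have h2 : ENNReal.ofReal (ρ ^ (-(n : ℝ) / p)) = ENNReal.ofReal (ρ ^ (-(n : ℝ))) ^ (1 / p) := by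
      rw [ENNReal.ofReal_rpow_of_pos (by positivity), ← Real.rpow_mul hρ.le]
      congr 2
      ring
    rw [h2, ← ENNReal.mul_rpow_of_nonneg _ _ (by positivity)]
    refine ENNReal.rpow_le_rpow ((mul_le_mul_right h1 _).trans (le_of_eq ?_)) (by positivity)
    rw [Measure.addHaar_ball_of_pos _ _ hρ, finrank_euclideanSpace, Fintype.card_fin,
      ENNReal.mul_inv (Or.inr measure_ball_lt_top.ne)
      (Or.inr hB0), Real.rpow_neg hρ.le, Real.rpow_natCast,
      ENNReal.ofReal_inv_of_pos (by positivity), two_mul, pow_add,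
      ENNReal.ofReal_mul (by positivity)]
    have hρn : ENNReal.ofReal (ρ ^ n) ≠ 0 := by
      simp only [ne_eq, ENNReal.ofReal_eq_zero, not_le]
      positivity
    have ha : ENNReal.ofReal (ρ ^ n) ≠ ⊤ := ENNReal.ofReal_ne_top
    generalize ENNReal.ofReal (ρ ^ n) = a at *
    rw [show ∀ a' b c d : ℝ≥0∞, a' * (a' * b * (c * (a * a) * d)) =
      (a' * a) * (a' * a) * (b * c * d) by intros; ring, ENNReal.inv_mul_cancel hρn ha]
    ring
  · refine ENNReal.rpow_lt_top_of_nonneg (by positivity) ?_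
    exact ENNReal.mul_ne_top (ENNReal.mul_ne_top (ENNReal.inv_ne_top.2 hB0) hC)
      (ENNReal.rpow_ne_top_of_nonneg hp0.le hu'.ne)

/-- Normalizing the mean on one fixed ball fixes the additive constant for all larger balls at once;
`K` depends on `R` but not on `u`. -/
theorem exists_eLpNorm_ball_le (hs0 : 0 < s) (hs1 : s ≤ 1) (hp : 1 ≤ p) (hsp : s * p = n)
    {R : ℝ} (hR : 1 ≤ R) :
    ∃ K : ℝ≥0∞, K ≠ ⊤ ∧ ∀ u : Euc n → ℝ, MemLpLoc n p u → gagliardo n s p u < ⊤ →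
      ⨍ y in ball (0 : Euc n) 1, u y = 0 →
      eLpNorm u (ENNReal.ofReal p) (volume.restrict (ball 0 R)) ≤ K * gagliardo n s p u := by
  have hp0 : 0 < p := by linarith
  obtain ⟨C, hC, h⟩ := exists_lintegral_ball_prod_le hs0 hs1 hp hsp
  have hB0 : volume (ball (0 : Euc n) 1) ≠ 0 := (measure_ball_pos _ _ one_pos).ne'
  refine ⟨((volume (ball (0 : Euc n) 1))⁻¹ * (C * ENNReal.ofReal (R ^ (2 * n)))) ^ (1 / p), ?_,
    fun u hu hu' h0 => ?_⟩
  · refine ENNReal.rpow_ne_top_of_nonneg (by positivity) ?_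
    exact ENNReal.mul_ne_top (ENNReal.inv_ne_top.2 hB0) (ENNReal.mul_ne_top hC (by simp))
  · have h1 := (lintegral_ball_sub_average_le hp hu one_pos (ball_subset_ball hR)).trans
      (mul_le_mul_right (h u hu hu' 0 R (by linarith)) _)
    rw [h0] at h1
    simp only [sub_zero] at h1
    rw [eLpNorm_eq_lintegral_rpow_enorm_toReal (by simpa using hp0) (by simp),
      ENNReal.toReal_ofReal hp0.le]
    refine (ENNReal.rpow_le_rpow h1 (by positivity)).trans (le_of_eq ?_)
    rw [← mul_assoc, ENNReal.mul_rpow_of_nonneg _ _ (by positivity), ← ENNReal.rpow_mul,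
      mul_one_div_cancel hp0.ne', ENNReal.rpow_one]

end poincare

/-! ### Definiteness and completeness -/

section complete

variable {n : ℕ} {s p : ℝ}

theorem ae_of_ae_restrict_ball {P : Euc n → Prop}
    (h : ∀ m : ℕ, ∀ᵐ x ∂(volume.restrict (ball (0 : Euc n) (m + 1))), P x) : ∀ᵐ x, P x := by
  have h' : ∀ m : ℕ, ∀ᵐ x : Euc n, x ∈ ball (0 : Euc n) (m + 1) → P x := fun m =>
    (ae_restrict_iff' measurableSet_ball).1 (h m)
  filter_upwards [ae_all_iff.2 h'] with x hx
  obtain ⟨m, hm⟩ := exists_nat_gt ‖x‖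
  exact hx m (by rw [mem_ball_zero_iff]; linarith)

theorem const_mem_aeConst (n : ℕ) (c : ℝ) : (fun _ => c : Euc n → ℝ) ∈ aeConst n :=
  ⟨c, by simp⟩

theorem memLpLoc_const (n : ℕ) (p c : ℝ) : MemLpLoc n p fun _ => c := by
  refine ⟨aestronglyMeasurable_const, fun K hK => ?_⟩
  have : IsFiniteMeasure (volume.restrict K) := ⟨by simpa using hK.measure_lt_top⟩
  exact memLp_const c

theorem MemLpLoc.sub {u v : Euc n → ℝ} (hu : MemLpLoc n p u) (hv : MemLpLoc n p v) :
    MemLpLoc n p (u - v) := by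
  simpa [sub_eq_add_neg] using hu.add (hv.smul (-1))

theorem gagliardo_le_of_sub_mem_aeConst (hp : 1 ≤ p) {u v : Euc n → ℝ} (hu : MemLpLoc n p u)
    (hv : MemLpLoc n p v) (h : u - v ∈ aeConst n) : gagliardo n s p u ≤ gagliardo n s p v := by
  have h1 := gagliardo_add_le (s := s) hp (hu.sub hv) hv
  rwa [gagliardo_aeConst hp h, zero_add, sub_add_cancel] at h1

theorem gagliardo_eq_of_sub_mem_aeConst (hp : 1 ≤ p) {u v : Euc n → ℝ} (hu : MemLpLoc n p u)
    (hv : MemLpLoc n p v) (h : u - v ∈ aeConst n) : gagliardo n s p u = gagliardo n s p v :=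
  le_antisymm (gagliardo_le_of_sub_mem_aeConst hp hu hv h)
    (gagliardo_le_of_sub_mem_aeConst hp hv hu (by simpa using neg_mem h))

theorem gagliardo_sub_comm (hp : 1 ≤ p) (u v : Euc n → ℝ) :
    gagliardo n s p (u - v) = gagliardo n s p (v - u) := by
  rw [← gagliardo_neg hp, neg_sub]

/-- The representative of `u` modulo constants whose mean over the unit ball is zero. -/
def centered (u : Euc n → ℝ) : Euc n → ℝ := u - fun _ => ⨍ y in ball (0 : Euc n) 1, u y

theorem MemLpLoc.centered {u : Euc n → ℝ} (hu : MemLpLoc n p u) :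
    MemLpLoc n p (centered u) := hu.sub (memLpLoc_const n p _)

theorem sub_centered_mem_aeConst (u : Euc n → ℝ) : u - centered u ∈ aeConst n := by
  simpa [centered] using const_mem_aeConst n _

theorem setAverage_sub_ball (hp : 1 ≤ p) {u v : Euc n → ℝ} (hu : MemLpLoc n p u)
    (hv : MemLpLoc n p v) : ⨍ y in ball (0 : Euc n) 1, (u - v) y =
      (⨍ y in ball (0 : Euc n) 1, u y) - ⨍ y in ball (0 : Euc n) 1, v y := by
  simp only [setAverage_eq, Pi.sub_apply]
  rw [integral_sub (hu.integrableOn_ball hp 0 1) (hv.integrableOn_ball hp 0 1), smul_sub]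

theorem setAverage_centered (hp : 1 ≤ p) {u : Euc n → ℝ} (hu : MemLpLoc n p u) :
    ⨍ y in ball (0 : Euc n) 1, centered u y = 0 := by
  rw [centered, setAverage_sub_ball hp hu (memLpLoc_const n p _),
    setAverage_const (measure_ball_pos _ _ one_pos).ne' measure_ball_lt_top.ne, sub_self]

theorem mem_aeConst_of_gagliardo_eq_zero (hs0 : 0 < s) (hs1 : s ≤ 1) (hp : 1 ≤ p)
    (hsp : s * p = n) {u : Euc n → ℝ} (hu : MemLpLoc n p u) (h : gagliardo n s p u = 0) :
    u ∈ aeConst n := by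
  have hp0 : 0 < p := by linarith
  have h' : gagliardo n s p (centered u) = 0 := by
    rw [← h]
    exact (gagliardo_eq_of_sub_mem_aeConst hp hu hu.centered (sub_centered_mem_aeConst u)).symm
  have h0 : ∀ᵐ x, centered u x = 0 := by
    refine ae_of_ae_restrict_ball fun m => ?_
    obtain ⟨K, -, hK⟩ := exists_eLpNorm_ball_le hs0 hs1 hp hsp (R := (m : ℝ) + 1) (by simp)
    have h1 := hK _ hu.centered (by simp [h']) (setAverage_centered hp hu)
    rw [h', mul_zero, nonpos_iff_eq_zero,
      eLpNorm_eq_zero_iff hu.centered.1.restrict (by simpa using hp0)] at h1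
    exact h1
  refine ⟨⨍ y in ball (0 : Euc n) 1, u y, h0.mono fun x hx => ?_⟩
  simpa [centered, sub_eq_zero] using hx

/-- The support of `ψ` lies in a ball of finite measure, where Hölder turns `L^q` convergence into
`L^1` convergence. -/
theorem tendsto_integral_mul_of_eLpNorm {q : ℝ≥0∞} (hq : 1 ≤ q) {f : ℕ → Euc n → ℝ}
    {g : Euc n → ℝ} (hf : ∀ k, LocallyIntegrable (f k) volume) (hg : LocallyIntegrable g volume)
    (h : ∀ m : ℕ, Tendsto
      (fun k => eLpNorm (f k - g) q (volume.restrict (ball (0 : Euc n) (m + 1)))) atTop (𝓝 0))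
    {ψ : Euc n → ℝ} (hψ : Continuous ψ) (hc : HasCompactSupport ψ) :
    Tendsto (fun k => ∫ x, f k x * ψ x) atTop (𝓝 (∫ x, g x * ψ x)) := by
  obtain ⟨M, hM⟩ := hψ.bounded_above_of_compact_support hc
  obtain ⟨R, hR⟩ := hc.isCompact.isBounded.subset_ball 0
  obtain ⟨m, hm⟩ := exists_nat_gt R
  have hsupp : Function.support ψ ⊆ ball (0 : Euc n) (m + 1) :=
    (subset_tsupport ψ).trans (hR.trans (ball_subset_ball (by linarith)))
  have : IsFiniteMeasure (volume.restrict (ball (0 : Euc n) (m + 1))) :=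
    ⟨by simpa using measure_ball_lt_top⟩
  refine tendsto_integral_of_L1' _ (integrable_mul_test hg hψ hc).aestronglyMeasurable
    (Eventually.of_forall fun k => integrable_mul_test (hf k) hψ hc) ?_
  set ν := volume.restrict (ball (0 : Euc n) (m + 1)) with hν
  have hbd : ∀ k, eLpNorm ((fun x => f k x * ψ x) - fun x => g x * ψ x) 1 volume ≤
      ENNReal.ofReal M * (ν univ ^ (1 / (1 : ℝ≥0∞).toReal - 1 / q.toReal)) *
        eLpNorm (f k - g) q ν := by
    intro k
    have h1 : (Function.support ((fun x => f k x * ψ x) - fun x => g x * ψ x)) ⊆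
        ball (0 : Euc n) (m + 1) := by
      refine subset_trans (fun x hx => ?_) hsupp
      intro h0
      exact hx (by simp [h0])
    rw [← eLpNorm_restrict_eq_of_support_subset h1, mul_assoc]
    refine (eLpNorm_le_mul_eLpNorm_of_ae_le_mul (g := f k - g) (c := M)
      (Eventually.of_forall fun x => ?_) 1).trans ?_
    · rw [Pi.sub_apply, ← sub_mul, norm_mul, mul_comm, Pi.sub_apply]
      gcongr
      exact hM x
    · gcongr
      rw [mul_comm]
      exact eLpNorm_le_eLpNorm_mul_rpow_measure_univ hq
        ((hf k).aestronglyMeasurable.sub hg.aestronglyMeasurable).restrict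
  have hlim : Tendsto (fun k => ENNReal.ofReal M *
      (ν univ ^ (1 / (1 : ℝ≥0∞).toReal - 1 / q.toReal)) * eLpNorm (f k - g) q ν) atTop (𝓝 0) := by
    have := ENNReal.Tendsto.const_mul (a := ENNReal.ofReal M *
      (ν univ ^ (1 / (1 : ℝ≥0∞).toReal - 1 / q.toReal))) (h m) (Or.inr ?_)
    · simpa using this
    · refine ENNReal.mul_ne_top (by simp) (ENNReal.rpow_ne_top_of_nonneg ?_ (measure_ne_top _ _))
      rcases eq_or_ne q ⊤ with rfl | hq'
      · simp
      have : 1 ≤ q.toReal := by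
        rwa [← ENNReal.ofReal_le_iff_le_toReal hq', ENNReal.ofReal_one]
      rw [sub_nonneg, ENNReal.toReal_one]
      exact one_div_le_one_div_of_le one_pos this
  exact tendsto_of_tendsto_of_tendsto_of_le_of_le tendsto_const_nhds hlim (fun _ => zero_le) hbd

/-- The weak gradient is a closed operator: both sides of its defining identity pass to the limit.
-/
theorem isWeakGradient_of_tendsto (hp : 1 ≤ p) {w : ℕ → Euc n → ℝ} {u : Euc n → ℝ}
    {H : ℕ → Euc n → Euc n} {G : Euc n → Euc n} (hw : ∀ k, MemLpLoc n p (w k))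
    (hu : MemLpLoc n p u) (hH : ∀ k, IsWeakGradient n (w k) (H k))
    (hG : MemLp G (ENNReal.ofReal p) volume)
    (h : ∀ m : ℕ, Tendsto (fun k => eLpNorm (w k - u) (ENNReal.ofReal p)
      (volume.restrict (ball (0 : Euc n) (m + 1)))) atTop (𝓝 0))
    (h' : Tendsto (fun k => eLpNorm (H k - G) (ENNReal.ofReal p) volume) atTop (𝓝 0)) :
    IsWeakGradient n u G := by
  have hpe : 1 ≤ ENNReal.ofReal p := by simpa using hp
  have hGl : LocallyIntegrable G volume := hG.locallyIntegrable hpe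
  refine ⟨hGl, fun φ hφ v => ?_⟩
  have h1 := tendsto_integral_mul_of_eLpNorm hpe (fun k => (hw k).locallyIntegrable hp)
    (hu.locallyIntegrable hp) h (hφ.continuous_fderiv v) (hφ.compact_fderiv v)
  have h2 : Tendsto (fun k => ∫ x, inner ℝ (H k x) v * φ x) atTop
      (𝓝 (∫ x, inner ℝ (G x) v * φ x)) := by
    refine tendsto_integral_mul_of_eLpNorm hpe (fun k => locallyIntegrable_inner (hH k).1 v)
      (locallyIntegrable_inner hGl v) (fun m => ?_) hφ.1.continuous hφ.2
    have hbd : ∀ k, eLpNorm ((fun x => inner ℝ (H k x) v) - fun x => inner ℝ (G x) v)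
        (ENNReal.ofReal p) (volume.restrict (ball (0 : Euc n) (m + 1))) ≤
        ENNReal.ofReal ‖v‖ * eLpNorm (H k - G) (ENNReal.ofReal p) volume := by
      intro k
      refine (eLpNorm_le_mul_eLpNorm_of_ae_le_mul (g := H k - G) (c := ‖v‖)
        (Eventually.of_forall fun x => ?_) _).trans ?_
      · rw [Pi.sub_apply, ← inner_sub_left, mul_comm]
        exact norm_inner_le_norm _ _
      · gcongr
        exact Measure.restrict_le_self
    refine tendsto_of_tendsto_of_tendsto_of_le_of_le tendsto_const_nhds ?_
      (fun _ => zero_le) hbd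
    simpa using ENNReal.Tendsto.const_mul (a := ENNReal.ofReal ‖v‖) h' (Or.inr (by simp))
  have h3 : ∀ k, ∫ x, w k x * fderiv ℝ φ x v = - ∫ x, inner ℝ (H k x) v * φ x :=
    fun k => (hH k).2 φ hφ v
  simp only [h3] at h1
  exact tendsto_nhds_unique h1 h2.neg

theorem diffQuot_sub (u v : Euc n → ℝ) :
    diffQuot n s p (u - v) = diffQuot n s p u - diffQuot n s p v := by
  ext z
  simp only [diffQuot, Pi.sub_apply]
  ring

/-- Upgrades local convergence to convergence in the seminorm for a rapidly Cauchy sequence. For `s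
< 1` the difference quotients converge almost everywhere, which identifies their `L^p` limit. For `s
= 1` the `L^p` limit of the gradients is the gradient of `u` by closedness. -/
theorem tendsto_gagliardo_sub (hs0 : 0 < s) (hs1 : s ≤ 1) (hp : 1 ≤ p)
    {w : ℕ → Euc n → ℝ} {u : Euc n → ℝ} (hw : ∀ k, MemLpLoc n p (w k))
    (hw' : ∀ k, gagliardo n s p (w k) < ⊤) (hu : MemLpLoc n p u)
    (hae : ∀ᵐ x, Tendsto (fun k => w k x) atTop (𝓝 (u x)))
    (h : ∀ m : ℕ, Tendsto (fun k => eLpNorm (w k - u) (ENNReal.ofReal p)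
      (volume.restrict (ball (0 : Euc n) (m + 1)))) atTop (𝓝 0))
    {B : ℕ → ℝ≥0∞} (hB : ∑' i, B i ≠ ⊤)
    (hc : ∀ N k m : ℕ, N ≤ k → N ≤ m → gagliardo n s p (w k - w m) < B N) :
    Tendsto (fun k => gagliardo n s p (w k - u)) atTop (𝓝 0) := by
  have hp0 : 0 < p := by linarith
  have hpe : 1 ≤ ENNReal.ofReal p := by simpa using hp
  rcases hs1.lt_or_eq with hs | rfl
  · refine tendsto_gagliardo_of_diffQuot hp hs.ne ?_
    simp only [diffQuot_sub]
    have hpos : 0 < s * (1 - s) := mul_pos hs0 (by linarith)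
    set c := ENNReal.ofReal (s * (1 - s)) ^ (1 / p) with hcdef
    have hc0 : c ≠ 0 := by simp [hcdef, ENNReal.rpow_eq_zero_iff, hpos]
    have hctop : c ≠ ⊤ := ENNReal.rpow_ne_top_of_nonneg (by positivity) (by simp)
    refine Lp.cauchy_tendsto_of_tendsto (B := fun N => c⁻¹ * B N)
      (fun k => aestronglyMeasurable_diffQuot (hw k).1) _ ?_ (fun N k m hk hm => ?_) ?_
    · rw [ENNReal.tsum_mul_left]
      exact ENNReal.mul_ne_top (ENNReal.inv_ne_top.2 hc0) hB
    · have h1 := hc N k m hk hm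
      rw [gagliardo_eq_eLpNorm hp hs.ne, ← hcdef, diffQuot_sub] at h1
      rw [mul_comm, ← div_eq_mul_inv, ENNReal.lt_div_iff_mul_lt (Or.inl hc0) (Or.inl hctop),
        mul_comm]
      exact h1
    · filter_upwards [Measure.quasiMeasurePreserving_fst.ae hae,
        Measure.quasiMeasurePreserving_snd.ae hae] with z h1 h2
      exact (h1.sub h2).const_mul _
  · choose H hH hHp using fun k => exists_isWeakGradient (hw' k)
    have hl : ∀ {v : Euc n → ℝ}, MemLpLoc n p v → LocallyIntegrable v volume :=
      fun hv => hv.locallyIntegrable hp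
    obtain ⟨G, hG, hlim⟩ := Lp.cauchy_complete_eLpNorm hpe hHp hB fun N k m hk hm => by
      rw [← ((hH k).sub (hl (hw k)) (hl (hw m)) (hH m)).gagliardo_eq]
      exact hc N k m hk hm
    have hGu := isWeakGradient_of_tendsto hp hw hu hH hG h hlim
    refine hlim.congr fun k => ?_
    rw [((hH k).sub (hl (hw k)) (hl hu) hGu).gagliardo_eq]

theorem mem_preW_iff (hs0 : 0 < s) (hs1 : s ≤ 1) (hp : 1 ≤ p) (hsp : s * p = n)
    {u : Euc n → ℝ} : u ∈ preW n s p hp ↔ MemLpLoc n p u ∧ gagliardo n s p u < ⊤ :=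
  ⟨fun h => ⟨h.1.1, h.2⟩,
    fun h => ⟨⟨h.1, campanato_lt_top hs0 hs1 hp hsp h.1 h.2⟩, h.2⟩⟩

theorem WDot.dist_mk {hp : 1 ≤ p} (u v : preW n s p hp) :
    dist (WDot.mk u : WDot n s p hp) (WDot.mk v) = (gagliardo n s p (u.1 - v.1)).toReal := by
  rw [dist_eq_norm, ← map_sub, WDot.norm_mk]
  rfl

/-- The summable rate `B` yields almost everywhere convergence on each ball without passing to a
subsequence, so one limit function serves all balls. -/
theorem exists_tendsto_centered (hs0 : 0 < s) (hs1 : s ≤ 1) (hp : 1 ≤ p) (hsp : s * p = n)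
    {w : ℕ → Euc n → ℝ} (hw : ∀ k, MemLpLoc n p (w k))
    (hw' : ∀ k, gagliardo n s p (w k) < ⊤) (hav : ∀ k, ⨍ y in ball (0 : Euc n) 1, w k y = 0)
    {B : ℕ → ℝ≥0∞} (hB : ∑' i, B i ≠ ⊤)
    (hc : ∀ N k m : ℕ, N ≤ k → N ≤ m → gagliardo n s p (w k - w m) < B N) :
    ∃ u, MemLpLoc n p u ∧ Tendsto (fun k => gagliardo n s p (w k - u)) atTop (𝓝 0) := by
  have hpe : 1 ≤ ENNReal.ofReal p := by simpa using hp
  have hK : ∀ m : ℕ, ∃ K : ℝ≥0∞, K ≠ ⊤ ∧ ∀ N i j : ℕ, N ≤ i → N ≤ j →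
      eLpNorm (w i - w j) (ENNReal.ofReal p) (volume.restrict (ball (0 : Euc n) (m + 1))) <
        (K + 1) * B N := by
    intro m
    obtain ⟨K, hKt, hK⟩ := exists_eLpNorm_ball_le hs0 hs1 hp hsp (R := (m : ℝ) + 1) (by simp)
    refine ⟨K, hKt, fun N i j hi hj => ?_⟩
    have h1 := hc N i j hi hj
    have hBt : B N ≠ ⊤ := ENNReal.ne_top_of_tsum_ne_top hB N
    have h2 := hK (w i - w j) ((hw i).sub (hw j)) (h1.trans_le le_top)
      (by rw [setAverage_sub_ball hp (hw i) (hw j), hav, hav, sub_zero])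
    refine (h2.trans (mul_le_mul_right h1.le K)).trans_lt ?_
    -- The extra `B N`, positive by `h1`, makes the inequality strict even when `K = 0`.
    rw [add_mul, one_mul]
    exact ENNReal.lt_add_right (ENNReal.mul_ne_top hKt hBt) (pos_of_gt h1).ne'
  choose K hKt hK using hK
  have hsum : ∀ m, ∑' N, (K m + 1) * B N ≠ ⊤ := fun m => by
    rw [ENNReal.tsum_mul_left]
    exact ENNReal.mul_ne_top (by simp [hKt m]) hB
  obtain ⟨u, hum, hae⟩ := exists_stronglyMeasurable_limit_of_tendsto_ae (fun k => (hw k).1)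
    (ae_of_ae_restrict_ball fun m => Lp.ae_tendsto_of_cauchy_eLpNorm
      (fun k => (hw k).1.restrict) hpe (hsum m) (hK m))
  have hlim : ∀ m : ℕ, Tendsto (fun k => eLpNorm (w k - u) (ENNReal.ofReal p)
      (volume.restrict (ball (0 : Euc n) (m + 1)))) atTop (𝓝 0) := fun m =>
    Lp.cauchy_tendsto_of_tendsto (fun k => (hw k).1.restrict) u (hsum m) (hK m)
      (ae_restrict_of_ae hae)
  have hball : ∀ {v : Euc n → ℝ}, MemLpLoc n p v → ∀ m : ℕ,
      MemLp v (ENNReal.ofReal p) (volume.restrict (ball (0 : Euc n) (m + 1))) :=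
    fun hv m => (hv.2 _ (isCompact_closedBall 0 ((m : ℝ) + 1))).mono_measure
      (Measure.restrict_mono ball_subset_closedBall le_rfl)
  have hu : MemLpLoc n p u := by
    refine ⟨hum.aestronglyMeasurable, fun A hA => ?_⟩
    obtain ⟨R, hR⟩ := hA.isBounded.subset_ball (0 : Euc n)
    obtain ⟨m, hm⟩ := exists_nat_gt R
    have h1 := Lp.memLp_of_cauchy_tendsto hpe (fun k => hball (hw k) m) u
      hum.aestronglyMeasurable (hlim m)
    exact h1.mono_measure
      (Measure.restrict_mono (hR.trans (ball_subset_ball (by linarith))) le_rfl)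
  exact ⟨u, hu, tendsto_gagliardo_sub hs0 hs1 hp hw hw' hu hae hlim hB hc⟩

theorem completeSpace_WDot (hs0 : 0 < s) (hs1 : s ≤ 1) (hp : 1 ≤ p) (hsp : s * p = n) :
    CompleteSpace (WDot n s p hp) := by
  -- Only sequences with a prescribed geometric rate need a limit, which provides the summability
  -- used above.
  refine Metric.complete_of_convergent_controlled_sequences (fun N => (1 / 2 : ℝ) ^ N)
    (fun N => by positivity) fun W hW => ?_
  choose v hv using fun k => Submodule.mkQ_surjective
    ((aeConst n).submoduleOf (preW n s p hp)) (W k)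
  have hv' : ∀ k, WDot.mk (v k) = W k := hv
  have hm : ∀ k, MemLpLoc n p (v k).1 := fun k => memLpLoc_of_mem_preW (v k)
  have hcc : ∀ i j, gagliardo n s p (centered (v i).1 - centered (v j).1) =
      gagliardo n s p ((v i).1 - (v j).1) := by
    intro i j
    refine gagliardo_eq_of_sub_mem_aeConst hp ((hm i).centered.sub (hm j).centered)
      ((hm i).sub (hm j)) ?_
    have := sub_mem (sub_centered_mem_aeConst (v j).1) (sub_centered_mem_aeConst (v i).1)
    convert this using 1
    abel
  have hfin : ∀ i j, gagliardo n s p ((v i).1 - (v j).1) < ⊤ := fun i j => (v i - v j).2.2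
  have hcf : ∀ k, gagliardo n s p (centered (v k).1) < ⊤ := fun k => by
    rw [← gagliardo_eq_of_sub_mem_aeConst hp (hm k) (hm k).centered (sub_centered_mem_aeConst _)]
    exact (v k).2.2
  have hB : ∑' N, ENNReal.ofReal ((1 / 2 : ℝ) ^ N) ≠ ⊤ := by
    rw [← ENNReal.ofReal_tsum_of_nonneg (fun N => by positivity) summable_geometric_two]
    simp
  have hcau : ∀ N i j : ℕ, N ≤ i → N ≤ j →
      gagliardo n s p (centered (v i).1 - centered (v j).1) < ENNReal.ofReal ((1 / 2 : ℝ) ^ N) := by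
    intro N i j hi hj
    have := hW N i j hi hj
    rw [← hv', ← hv', WDot.dist_mk] at this
    rw [hcc]
    exact (ENNReal.lt_ofReal_iff_toReal_lt (hfin i j).ne).2 this
  obtain ⟨u, hu, hlim⟩ := exists_tendsto_centered hs0 hs1 hp hsp
    (fun k => (hm k).centered) hcf (fun k => setAverage_centered hp (hm k)) hB hcau
  have hlim' : Tendsto (fun k => gagliardo n s p ((v k).1 - u)) atTop (𝓝 0) := by
    refine hlim.congr fun k => ?_
    refine gagliardo_eq_of_sub_mem_aeConst hp ((hm k).centered.sub hu) ((hm k).sub hu) ?_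
    have := neg_mem (sub_centered_mem_aeConst (v k).1)
    convert this using 1
    abel
  have hu' : gagliardo n s p u < ⊤ := by
    obtain ⟨k, hk⟩ := (hlim'.eventually_lt_const (u := 1) (by simp)).exists
    have h1 := gagliardo_add_le (s := s) hp (hu.sub (hm k)) (hm k)
    rw [sub_add_cancel, gagliardo_sub_comm hp] at h1
    exact h1.trans_lt (ENNReal.add_lt_top.2 ⟨hk.trans (by simp), (v k).2.2⟩)
  refine ⟨WDot.mk ⟨u, (mem_preW_iff hs0 hs1 hp hsp).2 ⟨hu, hu'⟩⟩, ?_⟩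
  rw [tendsto_iff_dist_tendsto_zero]
  simp only [← hv', WDot.dist_mk]
  simpa [Function.comp_def] using (ENNReal.tendsto_toReal (by simp)).comp hlim'

end complete

/-! ### Density of test functions -/

section density

variable {n : ℕ} {s p : ℝ}

instance isAddHaarMeasure_volume_prod (n : ℕ) :
    (volume : Measure (Euc n × Euc n)).IsAddHaarMeasure :=
  Measure.prod.instIsAddHaarMeasure volume volume

theorem memLpLoc_of_continuous {v : Euc n → ℝ} (hv : Continuous v) : MemLpLoc n p v := by
  refine ⟨hv.aestronglyMeasurable, fun K hK => ?_⟩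
  have : IsFiniteMeasure (volume.restrict K) := ⟨by simpa using hK.measure_lt_top⟩
  obtain ⟨C, hC⟩ := hK.exists_bound_of_continuousOn hv.continuousOn
  exact MemLp.of_bound hv.aestronglyMeasurable C
    ((ae_restrict_iff' hK.measurableSet).2 (Eventually.of_forall hC))

/-- The weight `|x - y|` is invariant under diagonal translations, so the difference quotient of
`moll k u` is an average of diagonal translates of that of `u`. For `s = 1` the gradient is
mollified directly. Continuity of translations in `L^p` then concludes. -/
theorem tendsto_gagliardo_sub_moll (hs0 : 0 < s) (hs1 : s ≤ 1) (hp : 1 ≤ p) {u : Euc n → ℝ}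
    (hu : MemLpLoc n p u) (hum : StronglyMeasurable u) (hu' : gagliardo n s p u < ⊤) :
    Tendsto (fun k => gagliardo n s p (u - moll k u)) atTop (𝓝 0) := by
  have hpe : 1 ≤ ENNReal.ofReal p := by simpa using hp
  have hul := hu.locallyIntegrable hp
  rcases hs1.lt_or_eq with hs | rfl
  · refine tendsto_gagliardo_of_diffQuot hp hs.ne ?_
    have h := eLpNorm_integral_translate_sub (n := n) hpe (by simp)
      (stronglyMeasurable_diffQuot (n := n) (s := s) (p := p) hum)
      (μ := volume) ⟨(stronglyMeasurable_diffQuot hum).aestronglyMeasurable,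
        eLpNorm_diffQuot_lt_top hp hs0 hs hu'⟩
      (a := fun t => (t, t)) (by fun_prop) rfl
    refine h.congr fun k => ?_
    congr 1
    ext z
    have h1 := fun x => integrable_sub_bumpMeasure (k := k) hul x
    have h2 : ∀ c : ℝ, Integrable (fun t => c * (u (z.1 - t) - u (z.2 - t))) (bumpMeasure n k) :=
      fun c => ((h1 _).sub (h1 _)).const_mul c
    simp only [diffQuot, Pi.sub_apply, moll, Prod.fst_sub, Prod.snd_sub, sub_sub_sub_cancel_right]
    rw [integral_sub (integrable_const _) (h2 _),
      integral_const_mul, integral_const_mul, integral_sub (h1 _) (h1 _), integral_const,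
      probReal_univ, one_smul]
    ring
  · obtain ⟨G₀, hG₀, hG₀p⟩ := exists_isWeakGradient hu'
    -- `eLpNorm_integral_translate_sub` needs a strongly measurable function, and altering the weak
    -- gradient on a null set is harmless.
    obtain ⟨G, hGm, hGe⟩ := hG₀.1.aestronglyMeasurable
    have hGp : MemLp G (ENNReal.ofReal p) volume := hG₀p.ae_eq hGe
    have hGl : LocallyIntegrable G volume := hGp.locallyIntegrable hpe
    have hG : IsWeakGradient n u G := by
      refine ⟨hGl, fun φ hφ v => (hG₀.2 φ hφ v).trans ?_⟩
      congr 1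
      refine integral_congr_ae ?_
      filter_upwards [hGe] with x hx
      rw [hx]
    have h := eLpNorm_integral_translate_sub (n := n) (μ := volume) hpe (by simp)
      hGm hGp (a := id) continuous_id rfl
    refine h.congr fun k => ?_
    have hv := contDiff_moll (k := k) hul
    rw [(hG.sub hul hv.continuous.locallyIntegrable (isWeakGradient_gradient hv)).gagliardo_eq,
      gradient_moll hul hG]
    congr 1
    ext1 z
    have h1 := integrable_sub_bumpMeasure (k := k) hGl z
    simp only [id_eq, Pi.sub_apply, moll]
    rw [integral_sub (integrable_const _) h1, integral_const, probReal_univ, one_smul]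

theorem exists_contDiff_gagliardo_sub_le (hs0 : 0 < s) (hs1 : s ≤ 1) (hp : 1 ≤ p)
    {u : Euc n → ℝ} (hu : MemLpLoc n p u) (hu' : gagliardo n s p u < ⊤) {ε : ℝ≥0∞} (hε : ε ≠ 0) :
    ∃ v, ContDiff ℝ ∞ v ∧ gagliardo n s p (u - v) ≤ ε := by
  set w := hu.1.mk u with hw
  have hae : u =ᵐ[volume] w := hu.1.ae_eq_mk
  have hwm : MemLpLoc n p w := ⟨hu.1.stronglyMeasurable_mk.aestronglyMeasurable,
    fun K hK => (hu.2 K hK).ae_eq (ae_restrict_of_ae hae)⟩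
  have hc : u - w ∈ aeConst n := ⟨0, hae.mono fun x hx => by simp [hx]⟩
  have h := tendsto_gagliardo_sub_moll hs0 hs1 hp hwm hu.1.stronglyMeasurable_mk
    (by rwa [← gagliardo_eq_of_sub_mem_aeConst hp hu hwm hc])
  obtain ⟨k, hk⟩ := (ENNReal.tendsto_nhds_zero.1 h ε (pos_iff_ne_zero.2 hε)).exists
  have hv := contDiff_moll (k := k) (hwm.locallyIntegrable hp)
  refine ⟨moll k w, hv, ?_⟩
  rwa [gagliardo_eq_of_sub_mem_aeConst hp (hu.sub (memLpLoc_of_continuous hv.continuous))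
    (hwm.sub (memLpLoc_of_continuous hv.continuous)) (by simpa using hc)]

/-- A smooth truncation of `v` at height `k + 1`. -/
def sinTrunc (k : ℕ) (v : Euc n → ℝ) : Euc n → ℝ :=
  fun x => ((k : ℝ) + 1) * Real.sin (((k : ℝ) + 1)⁻¹ * v x)

theorem contDiff_sinTrunc (k : ℕ) {v : Euc n → ℝ} (hv : ContDiff ℝ ∞ v) :
    ContDiff ℝ ∞ (sinTrunc k v) :=
  contDiff_const.mul (Real.contDiff_sin.comp (contDiff_const.mul hv))

theorem norm_sinTrunc_le (k : ℕ) (v : Euc n → ℝ) (x : Euc n) : ‖sinTrunc k v x‖ ≤ (k : ℝ) + 1 := by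
  rw [sinTrunc, norm_mul, Real.norm_of_nonneg (by positivity)]
  exact mul_le_of_le_one_right (by positivity) (Real.abs_sin_le_one _)

theorem abs_sinTrunc_sub_le (k : ℕ) (v : Euc n → ℝ) (x y : Euc n) :
    |sinTrunc k v x - sinTrunc k v y| ≤ |v x - v y| := by
  have hk : (0 : ℝ) < (k : ℝ) + 1 := by positivity
  rw [sinTrunc, sinTrunc, ← mul_sub, abs_mul, abs_of_pos hk]
  refine (mul_le_mul_of_nonneg_left (Real.abs_sin_sub_sin_le _ _) hk.le).trans (le_of_eq ?_)
  rw [← mul_sub, abs_mul, abs_of_pos (inv_pos.2 hk), mul_inv_cancel_left₀ hk.ne']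

theorem tendsto_natCast_add_one : Tendsto (fun k : ℕ => (k : ℝ) + 1) atTop atTop :=
  tendsto_atTop_add_const_right _ _ tendsto_natCast_atTop_atTop

theorem tendsto_sinTrunc (v : Euc n → ℝ) (x : Euc n) :
    Tendsto (fun k => sinTrunc k v x) atTop (𝓝 (v x)) := by
  -- The limit of `c sin(v / c)` as `c → ∞` is the derivative of the sine at `0` times `v`.
  have := ((Real.hasDerivAt_sin 0).hasFDerivAt.lim_real (v x)).comp tendsto_natCast_add_one
  simpa [Function.comp_def, sinTrunc] using this

theorem gradient_sinTrunc (k : ℕ) {v : Euc n → ℝ} (hv : ContDiff ℝ ∞ v) (x : Euc n) :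
    gradient (sinTrunc k v) x = Real.cos (((k : ℝ) + 1)⁻¹ * v x) • gradient v x := by
  have hk : (k : ℝ) + 1 ≠ 0 := by positivity
  refine ext_inner_right ℝ fun w => ?_
  rw [inner_smul_left, inner_gradient, inner_gradient]
  have h1 := (hv.differentiable (by simp) x).hasFDerivAt
  have h2 := ((h1.const_mul ((k : ℝ) + 1)⁻¹).sin.const_mul ((k : ℝ) + 1)).fderiv
  have h3 : fderiv ℝ (sinTrunc k v) x = _ := h2
  rw [h3]
  simp only [_root_.smul_apply, smul_eq_mul, conj_trivial]
  field_simp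

/-- The sine is smooth, bounded and `1`-Lipschitz: the truncations have difference quotients and
gradients no larger than those of `v`, and converge to `v` pointwise. Dominated convergence applies
with twice the norm of the original. -/
theorem exists_bounded_gagliardo_sub_le (hs0 : 0 < s) (hs1 : s ≤ 1) (hp : 1 ≤ p)
    {v : Euc n → ℝ} (hv : ContDiff ℝ ∞ v) (hv' : gagliardo n s p v < ⊤) {ε : ℝ≥0∞} (hε : ε ≠ 0) :
    ∃ w, ContDiff ℝ ∞ w ∧ (∃ M, ∀ x, ‖w x‖ ≤ M) ∧ gagliardo n s p (v - w) ≤ ε := by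
  have hp0 : 0 < p := by linarith
  have hpne : ENNReal.ofReal p ≠ 0 := by simpa using hp0
  have h : Tendsto (fun k => gagliardo n s p (v - sinTrunc k v)) atTop (𝓝 0) := by
    rcases hs1.lt_or_eq with hs | rfl
    · refine tendsto_gagliardo_of_diffQuot hp hs.ne ?_
      have hm : ∀ {v : Euc n → ℝ}, Continuous v → AEStronglyMeasurable (diffQuot n s p v) volume :=
        fun hv => aestronglyMeasurable_diffQuot hv.aestronglyMeasurable
      have hL : MemLp (diffQuot n s p v) (ENNReal.ofReal p) volume :=
        ⟨hm hv.continuous, eLpNorm_diffQuot_lt_top hp hs0 hs hv'⟩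
      refine tendsto_eLpNorm_zero_of_dominated hpne (by simp)
        (fun k => hm (hv.continuous.sub (contDiff_sinTrunc k hv).continuous))
        (hL.norm.const_mul 2) (fun k => Eventually.of_forall fun z => ?_)
        (Eventually.of_forall fun z => ?_)
      · simp only [diffQuot, norm_mul, Pi.sub_apply]
        rw [mul_left_comm]
        gcongr
        rw [sub_sub_sub_comm, two_mul]
        exact (norm_sub_le _ _).trans (add_le_add le_rfl (abs_sinTrunc_sub_le k v _ _))
      · have h1 := (tendsto_const_nhds (x := v z.1)).sub (tendsto_sinTrunc v z.1)
        have h2 := (tendsto_const_nhds (x := v z.2)).sub (tendsto_sinTrunc v z.2)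
        have h3 := (h1.sub h2).const_mul (‖z.1 - z.2‖ ^ (-(((n : ℝ) + s * p) / p)))
        simpa [diffQuot] using h3
    · have hg := continuous_gradient hv
      have hL : MemLp (gradient v) (ENNReal.ofReal p) volume := by
        refine ⟨hg.aestronglyMeasurable, ?_⟩
        rwa [← (isWeakGradient_gradient hv).gagliardo_eq]
      have hgk := fun k => continuous_gradient (contDiff_sinTrunc k hv)
      have h1 := tendsto_eLpNorm_zero_of_dominated (μ := volume) hpne (by simp)
        (F := fun k => gradient v - gradient (sinTrunc k v))
        (fun k => (hg.sub (hgk k)).aestronglyMeasurable)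
        (hL.norm.const_mul 2) (fun k => Eventually.of_forall fun z => ?_)
        (Eventually.of_forall fun z => ?_)
      · refine h1.congr fun k => ?_
        rw [((isWeakGradient_gradient hv).sub hv.continuous.locallyIntegrable
          (contDiff_sinTrunc k hv).continuous.locallyIntegrable
          (isWeakGradient_gradient (contDiff_sinTrunc k hv))).gagliardo_eq]
      · rw [Pi.sub_apply, gradient_sinTrunc k hv, two_mul]
        refine (norm_sub_le _ _).trans (add_le_add le_rfl ?_)
        rw [norm_smul]
        exact mul_le_of_le_one_left (norm_nonneg _) (Real.abs_cos_le_one _)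
      · simp only [Pi.sub_apply, gradient_sinTrunc _ hv]
        have h2 : Tendsto (fun k : ℕ => Real.cos (((k : ℝ) + 1)⁻¹ * v z)) atTop (𝓝 1) := by
          have := (tendsto_inv_atTop_zero.comp tendsto_natCast_add_one).mul_const (v z)
          rw [zero_mul] at this
          simpa [Function.comp_def] using (Real.continuous_cos.tendsto 0).comp this
        simpa using (tendsto_const_nhds (x := gradient v z)).sub (h2.smul_const (gradient v z))
  obtain ⟨k, hk⟩ := (ENNReal.tendsto_nhds_zero.1 h ε (pos_iff_ne_zero.2 hε)).exists
  exact ⟨sinTrunc k v, contDiff_sinTrunc k hv, ⟨_, norm_sinTrunc_le k v⟩, hk⟩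

end density

/-! ### Cut-offs of small seminorm and approximation by test functions -/

section cutoff

variable {n : ℕ} {s p : ℝ}

/-- The average of the dilated bump functions `x ↦ χ (x / r j)`, `j < N`. -/
def cutoff (n N : ℕ) (r : ℕ → ℝ) : Euc n → ℝ :=
  fun x => (N : ℝ)⁻¹ * ∑ j ∈ Finset.range N, bump n 0 ((r j)⁻¹ • x)

variable {N : ℕ} {r : ℕ → ℝ}

theorem contDiff_bump_smul (c : ℝ) : ContDiff ℝ ∞ fun x : Euc n => bump n 0 (c • x) :=
  (bump n 0).contDiff.comp (contDiff_const_smul c)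

theorem isTest_cutoff (hr : ∀ j, 0 < r j) : IsTest n (cutoff n N r) := by
  refine ⟨contDiff_const.mul (ContDiff.sum fun j _ => contDiff_bump_smul _), ?_⟩
  refine HasCompactSupport.mul_left (f := fun _ => (N : ℝ)⁻¹) ?_
  have h : ∀ M : ℕ, HasCompactSupport
      fun x : Euc n => ∑ j ∈ Finset.range M, bump n 0 ((r j)⁻¹ • x) := by
    intro M
    induction M with
    | zero => simpa using! HasCompactSupport.zero
    | succ M ih =>
      simp only [Finset.sum_range_succ]
      refine ih.add ?_
      exact (bump n 0).hasCompactSupport.comp_homeomorph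
        (Homeomorph.smulOfNeZero (r M)⁻¹ (inv_ne_zero (hr M).ne'))
  exact h N

theorem cutoff_nonneg (x : Euc n) : 0 ≤ cutoff n N r x :=
  mul_nonneg (by positivity) (Finset.sum_nonneg fun _ _ => (bump n 0).nonneg)

theorem cutoff_le_one (x : Euc n) : cutoff n N r x ≤ 1 := by
  have h : ∑ j ∈ Finset.range N, bump n 0 ((r j)⁻¹ • x) ≤ N := by
    refine (Finset.sum_le_sum fun j _ => (bump n 0).le_one).trans ?_
    simp
  exact (mul_le_mul_of_nonneg_left h (by positivity)).trans (inv_mul_le_one (a := (N : ℝ)))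

/-- The inner radius of `bump n 0` is `1 / 2`, whence the factor `2`. -/
theorem cutoff_eq_one (hN : 0 < N) (hr : ∀ j, 0 < r j) {x : Euc n} (hx : ∀ j, 2 * ‖x‖ ≤ r j) :
    cutoff n N r x = 1 := by
  have h : ∀ j, bump n 0 ((r j)⁻¹ • x) = 1 := fun j => by
    refine (bump n 0).one_of_mem_closedBall ?_
    rw [mem_closedBall_zero_iff, norm_smul, norm_inv, Real.norm_of_nonneg (hr j).le,
      inv_mul_le_iff₀ (hr j)]
    simp only [bump]
    have := hx j
    norm_num
    linarith
  simp only [cutoff, h, Finset.sum_const, Finset.card_range, nsmul_eq_mul, mul_one]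
  exact inv_mul_cancel₀ (by positivity)

/-- Rescaling produces the factor `r^(-(n + s p) / p)`. Since `n + s p = 2n` is the dimension of the
product space, this is exactly the `L^p`-isometric dilation. -/
theorem diffQuot_cutoff (hp : 0 < p) (hsp : s * p = n) (hr : ∀ j, 0 < r j) :
    diffQuot n s p (cutoff n N r) = fun z => (N : ℝ)⁻¹ • ∑ j ∈ Finset.range N,
      dilate (ENNReal.ofReal p).toReal (r j) (diffQuot n s p (bump n 0)) z := by
  ext z
  simp only [diffQuot, cutoff, dilate, ENNReal.toReal_ofReal hp.le, smul_eq_mul, ← mul_sub,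
    ← Finset.sum_sub_distrib, Module.finrank_prod, finrank_euclideanSpace, Fintype.card_fin]
  rw [mul_left_comm, Finset.mul_sum]
  congr 1
  refine Finset.sum_congr rfl fun j _ => ?_
  have hrj := hr j
  rw [Prod.smul_fst, Prod.smul_snd, ← smul_sub, norm_smul, norm_inv, Real.norm_of_nonneg hrj.le,
    Real.mul_rpow (by positivity) (norm_nonneg _), Real.inv_rpow hrj.le, ← mul_assoc, ← mul_assoc,
    hsp, Nat.cast_add, mul_inv_cancel₀ (by positivity), one_mul]

/-- The chain rule factor `r⁻¹` is the isometric factor `r^(-n / p)`, because `p = n`. -/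
theorem gradient_cutoff (hp : 0 < p) (hn : p = n) :
    gradient (cutoff n N r) = fun z => (N : ℝ)⁻¹ • ∑ j ∈ Finset.range N,
      dilate (ENNReal.ofReal p).toReal (r j) (gradient (bump n 0)) z := by
  ext1 z
  refine ext_inner_right ℝ fun v => ?_
  rw [inner_gradient, inner_smul_left, sum_inner]
  have h1 : ∀ j ∈ Finset.range N, HasFDerivAt (fun x : Euc n => bump n 0 ((r j)⁻¹ • x))
      ((r j)⁻¹ • fderiv ℝ (bump n 0) ((r j)⁻¹ • z)) z := by
    intro j _
    rw [← fderiv_comp_smul]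
    exact ((contDiff_bump_smul _).differentiable (by simp) z).hasFDerivAt
  have h2 : fderiv ℝ (cutoff n N r) z = _ :=
    ((HasFDerivAt.fun_sum h1).const_mul (N : ℝ)⁻¹).fderiv
  rw [h2]
  simp only [_root_.smul_apply, _root_.sum_apply, smul_eq_mul, conj_trivial,
    dilate, inner_smul_left, inner_gradient, finrank_euclideanSpace, Fintype.card_fin,
    ENNReal.toReal_ofReal hp.le]
  rw [← hn, div_self hp.ne']
  simp [Real.rpow_neg_one]

theorem isTest_bump (n : ℕ) : IsTest n (bump n 0) :=
  ⟨(bump n 0).contDiff, (bump n 0).hasCompactSupport⟩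

/-- At the critical exponent `s p = n`, compact sets can be cut off at arbitrarily small cost. -/
theorem exists_cutoff (hn : 0 < n) (hs0 : 0 < s) (hs1 : s ≤ 1) (hp : 1 < p) (hsp : s * p = n)
    (K : ℝ) {ε : ℝ≥0∞} (hε : ε ≠ 0) :
    ∃ Ψ : Euc n → ℝ, IsTest n Ψ ∧ (∀ x, 0 ≤ Ψ x) ∧ (∀ x, Ψ x ≤ 1) ∧ (∀ x, ‖x‖ ≤ K → Ψ x = 1) ∧
      gagliardo n s p Ψ ≤ ε := by
  have : Nonempty (Fin n) := ⟨⟨0, hn⟩⟩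
  have hp0 : 0 < p := by linarith
  have hpe : 1 < ENNReal.ofReal p := by simpa using hp
  have key : ∀ {N : ℕ} {r : ℕ → ℝ}, 0 < N → (∀ j, 0 < r j ∧ 2 * K ≤ r j) →
      gagliardo n s p (cutoff n N r) ≤ ε → ∃ Ψ : Euc n → ℝ, IsTest n Ψ ∧ (∀ x, 0 ≤ Ψ x) ∧
        (∀ x, Ψ x ≤ 1) ∧ (∀ x, ‖x‖ ≤ K → Ψ x = 1) ∧ gagliardo n s p Ψ ≤ ε :=
    fun hN hr h => ⟨_, isTest_cutoff fun j => (hr j).1, cutoff_nonneg, cutoff_le_one,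
      fun x hx => cutoff_eq_one hN (fun j => (hr j).1) fun j => by linarith [(hr j).2], h⟩
  rcases hs1.lt_or_eq with hs | rfl
  · set c := ENNReal.ofReal (s * (1 - s)) ^ (1 / p) with hc
    have hctop : c ≠ ⊤ := ENNReal.rpow_ne_top_of_nonneg (by positivity) (by simp)
    have hf : MemLp (diffQuot n s p (bump n 0)) (ENNReal.ofReal p) volume :=
      ⟨aestronglyMeasurable_diffQuot (isTest_bump n).1.continuous.aestronglyMeasurable,
        eLpNorm_diffQuot_lt_top hp.le hs0 hs (gagliardo_test_lt_top hp.le (isTest_bump n))⟩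
    obtain ⟨N, r, hN, hr, h⟩ := exists_eLpNorm_average_dilate_le hpe (by simp) hf (2 * K)
      (ε := ε / c) (ENNReal.div_ne_zero.2 ⟨hε, hctop⟩)
    refine key hN hr ?_
    rw [gagliardo_eq_eLpNorm hp.le hs.ne, diffQuot_cutoff hp0 hsp fun j => (hr j).1, ← hc]
    exact (mul_le_mul_right h c).trans ENNReal.mul_div_le
  · have hf : MemLp (gradient (bump n 0)) (ENNReal.ofReal p) volume := by
      refine ⟨(continuous_gradient (isTest_bump n).1).aestronglyMeasurable, ?_⟩
      rw [← (isWeakGradient_gradient (isTest_bump n).1).gagliardo_eq]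
      exact gagliardo_test_lt_top hp.le (isTest_bump n)
    obtain ⟨N, r, hN, hr, h⟩ := exists_eLpNorm_average_dilate_le hpe (by simp) hf (2 * K) hε
    refine key hN hr ?_
    have ht := isTest_cutoff (n := n) (N := N) fun j => (hr j).1
    rw [(isWeakGradient_gradient ht.1).gagliardo_eq,
      gradient_cutoff hp0 (by linarith)]
    exact h

/-- By the product rule the error is `1 - Ψ k` times the derivative of `w`, which vanishes by
dominated convergence, minus `w` times the derivative of `Ψ k`, which is at most `M` times a
vanishing seminorm. The second term is the reason for truncating first. -/
theorem tendsto_gagliardo_sub_mul_cutoff (hs0 : 0 < s) (hs1 : s ≤ 1) (hp : 1 ≤ p)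
    {w : Euc n → ℝ} (hw : ContDiff ℝ ∞ w) {M : ℝ} (hM : ∀ x, ‖w x‖ ≤ M)
    (hw' : gagliardo n s p w < ⊤) {Ψ : ℕ → Euc n → ℝ} (hΨ : ∀ k, IsTest n (Ψ k))
    (hΨ0 : ∀ k x, 0 ≤ Ψ k x) (hΨ1 : ∀ k x, Ψ k x ≤ 1)
    (hlim : ∀ x, Tendsto (fun k => Ψ k x) atTop (𝓝 1))
    (hg : Tendsto (fun k => gagliardo n s p (Ψ k)) atTop (𝓝 0)) :
    Tendsto (fun k => gagliardo n s p (w - Ψ k * w)) atTop (𝓝 0) := by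
  have hp0 : 0 < p := by linarith
  have hpe : 1 ≤ ENNReal.ofReal p := by simpa using hp
  have hpne : ENNReal.ofReal p ≠ 0 := by simpa using hp0
  have habs : ∀ k x, |1 - Ψ k x| ≤ 1 := fun k x => by
    rw [abs_of_nonneg (by linarith [hΨ1 k x])]; linarith [hΨ0 k x]
  have hlim' : ∀ x, Tendsto (fun k => 1 - Ψ k x) atTop (𝓝 0) := fun x => by
    simpa using (hlim x).const_sub 1
  rcases hs1.lt_or_eq with hs | rfl
  · have hpos : 0 < s * (1 - s) := mul_pos hs0 (by linarith)
    set c := ENNReal.ofReal (s * (1 - s)) ^ (1 / p) with hcdef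
    have hc0 : c ≠ 0 := by simp [hcdef, ENNReal.rpow_eq_zero_iff, hpos]
    have hctop : c ≠ ⊤ := ENNReal.rpow_ne_top_of_nonneg (by positivity) (by simp)
    have hm : ∀ {v : Euc n → ℝ}, Continuous v → AEStronglyMeasurable (diffQuot n s p v) volume :=
      fun hv => aestronglyMeasurable_diffQuot hv.aestronglyMeasurable
    have hL : MemLp (diffQuot n s p w) (ENNReal.ofReal p) volume :=
      ⟨hm hw.continuous, eLpNorm_diffQuot_lt_top hp hs0 hs hw'⟩
    have hΨc : ∀ k, Continuous (Ψ k) := fun k => (hΨ k).1.continuous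
    refine tendsto_gagliardo_of_diffQuot hp hs.ne ?_
    have h1 : Tendsto (fun k => eLpNorm (fun z : Euc n × Euc n =>
        (1 - Ψ k z.1) * diffQuot n s p w z) (ENNReal.ofReal p) volume) atTop (𝓝 0) := by
      refine tendsto_eLpNorm_zero_of_dominated hpne (by simp) (fun k => ?_) hL.norm
        (fun k => Eventually.of_forall fun z => ?_) (Eventually.of_forall fun z => ?_)
      · refine AEStronglyMeasurable.mul (Continuous.aestronglyMeasurable ?_) hL.1
        have := hΨc k
        fun_prop
      · rw [norm_mul]
        exact mul_le_of_le_one_left (norm_nonneg _) (habs k _)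
      · simpa using (hlim' z.1).mul_const (diffQuot n s p w z)
    have h2 : Tendsto (fun k => eLpNorm (fun z : Euc n × Euc n =>
        w z.2 * diffQuot n s p (Ψ k) z) (ENNReal.ofReal p) volume) atTop (𝓝 0) := by
      have hbd : ∀ k, eLpNorm (fun z : Euc n × Euc n => w z.2 * diffQuot n s p (Ψ k) z)
          (ENNReal.ofReal p) volume ≤ ENNReal.ofReal M * c⁻¹ * gagliardo n s p (Ψ k) := by
        intro k
        refine (eLpNorm_le_mul_eLpNorm_of_ae_le_mul (g := diffQuot n s p (Ψ k)) (c := M)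
          (Eventually.of_forall fun z => ?_) _).trans (le_of_eq ?_)
        · rw [norm_mul]
          gcongr
          exact hM _
        · rw [gagliardo_eq_eLpNorm hp hs.ne, ← hcdef, mul_assoc, ← mul_assoc c⁻¹,
            ENNReal.inv_mul_cancel hc0 hctop, one_mul]
      refine tendsto_of_tendsto_of_tendsto_of_le_of_le tendsto_const_nhds ?_
        (fun _ => zero_le) hbd
      simpa using ENNReal.Tendsto.const_mul (a := ENNReal.ofReal M * c⁻¹) hg
        (Or.inr (ENNReal.mul_ne_top (by simp) (ENNReal.inv_ne_top.2 hc0)))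
    refine tendsto_of_tendsto_of_tendsto_of_le_of_le tendsto_const_nhds
      (by simpa using h1.add h2) (fun _ => zero_le) fun k => ?_
    have he : diffQuot n s p (w - Ψ k * w) = (fun z => (1 - Ψ k z.1) * diffQuot n s p w z) -
        fun z => w z.2 * diffQuot n s p (Ψ k) z := by
      ext z
      simp only [diffQuot, Pi.sub_apply, Pi.mul_apply]
      ring
    rw [he]
    have := hΨc k
    have := hw.continuous
    refine eLpNorm_sub_le (AEStronglyMeasurable.mul (Continuous.aestronglyMeasurable ?_) hL.1)
      (AEStronglyMeasurable.mul (Continuous.aestronglyMeasurable ?_) (hm (hΨc k))) hpe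
    · fun_prop
    · fun_prop
  · have hgw := continuous_gradient hw
    have hgΨ : ∀ k, Continuous (gradient (Ψ k)) := fun k => continuous_gradient (hΨ k).1
    have hL : MemLp (gradient w) (ENNReal.ofReal p) volume := by
      refine ⟨hgw.aestronglyMeasurable, ?_⟩
      rwa [← (isWeakGradient_gradient hw).gagliardo_eq]
    have h1 : Tendsto (fun k => eLpNorm (fun z => (1 - Ψ k z) • gradient w z)
        (ENNReal.ofReal p) volume) atTop (𝓝 0) := by
      refine tendsto_eLpNorm_zero_of_dominated hpne (by simp) (fun k => ?_) hL.norm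
        (fun k => Eventually.of_forall fun z => ?_) (Eventually.of_forall fun z => ?_)
      · have := (hΨ k).1.continuous
        exact Continuous.aestronglyMeasurable (by fun_prop)
      · rw [norm_smul]
        exact mul_le_of_le_one_left (norm_nonneg _) (habs k _)
      · simpa using (hlim' z).smul_const (gradient w z)
    have h2 : Tendsto (fun k => eLpNorm (fun z => w z • gradient (Ψ k) z)
        (ENNReal.ofReal p) volume) atTop (𝓝 0) := by
      have hbd : ∀ k, eLpNorm (fun z => w z • gradient (Ψ k) z)
          (ENNReal.ofReal p) volume ≤ ENNReal.ofReal M * gagliardo n 1 p (Ψ k) := by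
        intro k
        rw [(isWeakGradient_gradient (hΨ k).1).gagliardo_eq]
        refine eLpNorm_le_mul_eLpNorm_of_ae_le_mul (Eventually.of_forall fun z => ?_) _
        rw [norm_smul]
        gcongr
        exact hM _
      refine tendsto_of_tendsto_of_tendsto_of_le_of_le tendsto_const_nhds ?_
        (fun _ => zero_le) hbd
      simpa using ENNReal.Tendsto.const_mul (a := ENNReal.ofReal M) hg (Or.inr (by simp))
    refine tendsto_of_tendsto_of_tendsto_of_le_of_le tendsto_const_nhds
      (by simpa using h1.add h2) (fun _ => zero_le) fun k => ?_
    have hc : ContDiff ℝ ∞ (w - Ψ k * w) := hw.sub ((hΨ k).1.mul hw)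
    have he : gradient (w - Ψ k * w) = (fun z => (1 - Ψ k z) • gradient w z) -
        fun z => w z • gradient (Ψ k) z := by
      ext1 z
      refine ext_inner_right ℝ fun v => ?_
      have d1 := (hw.differentiable (by simp) z).hasFDerivAt
      have d2 := ((hΨ k).1.differentiable (by simp) z).hasFDerivAt
      have d3 : fderiv ℝ (w - Ψ k * w) z = _ := (d1.sub (d2.mul d1)).fderiv
      rw [inner_gradient, d3]
      simp only [Pi.sub_apply, inner_sub_left, inner_smul_left, inner_gradient, conj_trivial,
        _root_.smul_apply, _root_.sub_apply, _root_.add_apply, smul_eq_mul]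
      ring
    rw [(isWeakGradient_gradient hc).gagliardo_eq, he]
    have := (hΨ k).1.continuous
    have := hw.continuous
    have := hgΨ k
    exact eLpNorm_sub_le (Continuous.aestronglyMeasurable (by fun_prop))
      (Continuous.aestronglyMeasurable (by fun_prop)) hpe

theorem exists_isTest_gagliardo_sub_le (hn : 0 < n) (hs0 : 0 < s) (hs1 : s ≤ 1) (hp : 1 < p)
    (hsp : s * p = n) {u : Euc n → ℝ} (hu : MemLpLoc n p u) (hu' : gagliardo n s p u < ⊤)
    {ε : ℝ≥0∞} (hε : ε ≠ 0) : ∃ φ, IsTest n φ ∧ gagliardo n s p (u - φ) ≤ ε := by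
  -- One third for each of the three approximations; the minimum with `1` keeps the intermediate
  -- seminorms finite even if `ε = ⊤`.
  have hε3 : min (ε / 3) 1 ≠ 0 := by
    simp [ENNReal.div_ne_zero.2 ⟨hε, ENNReal.ofNat_ne_top (n := 3)⟩]
  have hfin : ∀ {f g : Euc n → ℝ}, MemLpLoc n p f → MemLpLoc n p g → gagliardo n s p f < ⊤ →
      gagliardo n s p (f - g) ≤ min (ε / 3) 1 → gagliardo n s p g < ⊤ := by
    intro f g hf hg hf' h
    have h1 := gagliardo_add_le (s := s) hp.le (hg.sub hf) hf
    rw [sub_add_cancel, gagliardo_sub_comm hp.le] at h1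
    exact h1.trans_lt (ENNReal.add_lt_top.2 ⟨(h.trans (min_le_right _ _)).trans_lt (by simp), hf'⟩)
  obtain ⟨v, hv, huv⟩ := exists_contDiff_gagliardo_sub_le hs0 hs1 hp.le hu hu' hε3
  have hvm : MemLpLoc n p v := memLpLoc_of_continuous hv.continuous
  have hv' := hfin hu hvm hu' huv
  obtain ⟨w, hw, ⟨M, hM⟩, hvw⟩ := exists_bounded_gagliardo_sub_le hs0 hs1 hp.le hv hv' hε3
  have hwm : MemLpLoc n p w := memLpLoc_of_continuous hw.continuous
  have hw' := hfin hvm hwm hv' hvw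
  choose Ψ hΨ hΨ0 hΨ1 hΨe hΨg using fun k : ℕ =>
    exists_cutoff (n := n) hn hs0 hs1 hp hsp k (ε := (k : ℝ≥0∞)⁻¹) (by simp)
  have hlim := tendsto_gagliardo_sub_mul_cutoff hs0 hs1 hp.le hw hM hw' hΨ hΨ0 hΨ1
    (fun x => by
      refine tendsto_const_nhds.congr' ?_
      filter_upwards [(tendsto_natCast_atTop_atTop (R := ℝ)).eventually_ge_atTop ‖x‖] with k hk
      exact (hΨe k x hk).symm)
    (tendsto_of_tendsto_of_tendsto_of_le_of_le tendsto_const_nhds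
      ENNReal.tendsto_inv_nat_nhds_zero (fun _ => zero_le) hΨg)
  obtain ⟨k, hk⟩ := (ENNReal.tendsto_nhds_zero.1 hlim _ (pos_iff_ne_zero.2 hε3)).exists
  have hφ : IsTest n (Ψ k * w) := ⟨(hΨ k).1.mul hw, (hΨ k).2.mul_right⟩
  refine ⟨Ψ k * w, hφ, ?_⟩
  have e : u - Ψ k * w = (u - v) + ((v - w) + (w - Ψ k * w)) := by abel
  have h1 := gagliardo_add_le (s := s) hp.le (hvm.sub hwm) (hwm.sub hφ.memLpLoc)
  have h2 := gagliardo_add_le (s := s) hp.le (hu.sub hvm)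
    ((hvm.sub hwm).add (hwm.sub hφ.memLpLoc))
  rw [e]
  refine h2.trans ((add_le_add huv (h1.trans (add_le_add hvw hk))).trans ?_)
  calc min (ε / 3) 1 + (min (ε / 3) 1 + min (ε / 3) 1) ≤ ε / 3 + (ε / 3 + ε / 3) := by
        gcongr <;> exact min_le_left _ _
    _ = ε := by rw [← add_assoc, ENNReal.add_thirds]

end cutoff

/-! ### The isometric isomorphism -/

section isomorphism

variable {n : ℕ} {s p : ℝ} {hp : 1 ≤ p}

theorem TestW.mem_preW (hs0 : 0 < s) (hs1 : s ≤ 1) (hsp : s * p = n) (φ : TestW n s p hp) :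
    φ.toFun ∈ preW n s p hp :=
  (mem_preW_iff hs0 hs1 hp hsp).2 ⟨φ.isTest.memLpLoc, gagliardo_test_lt_top hp φ.isTest⟩

/-- The canonical isometry from `C_c^∞(ℝⁿ)` to `Ẇ^{s,p}(ℝⁿ)`. -/
def TestW.toWDot (hs0 : 0 < s) (hs1 : s ≤ 1) (hsp : s * p = n) :
    TestW n s p hp →ₗᵢ[ℝ] WDot n s p hp where
  toFun φ := WDot.mk ⟨φ.toFun, φ.mem_preW hs0 hs1 hsp⟩
  map_add' a b := by
    rw [← map_add]
    rfl
  map_smul' c a := by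
    rw [RingHom.id_apply, ← map_smul]
    rfl
  norm_map' φ := rfl

theorem denseRange_toWDot (hn : 0 < n) (hs0 : 0 < s) (hs1 : s ≤ 1) (hp1 : 1 < p)
    (hsp : s * p = n) : DenseRange (TestW.toWDot (hp := hp) hs0 hs1 hsp) := by
  rw [Metric.denseRange_iff]
  intro x ε hε
  obtain ⟨u, rfl⟩ := Submodule.mkQ_surjective ((aeConst n).submoduleOf (preW n s p hp)) x
  obtain ⟨φ, hφ, h⟩ := exists_isTest_gagliardo_sub_le hn hs0 hs1 hp1 hsp
    (memLpLoc_of_mem_preW u) u.2.2 (ε := ENNReal.ofReal (ε / 2)) (by simpa using hε)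
  refine ⟨(⟨φ, hφ⟩ : testSpace n), ?_⟩
  refine lt_of_le_of_lt ?_ (half_lt_self hε)
  refine le_trans (le_of_eq (WDot.dist_mk _ _)) ?_
  exact ENNReal.toReal_le_of_le_ofReal (by positivity) h

theorem WDot.eq_zero_of_norm_eq_zero (hs0 : 0 < s) (hs1 : s ≤ 1) (hsp : s * p = n)
    (w : WDot n s p hp) (hw : ‖w‖ = 0) : w = 0 := by
  obtain ⟨u, rfl⟩ := Submodule.mkQ_surjective ((aeConst n).submoduleOf (preW n s p hp)) w
  have h : gagliardo n s p u.1 = 0 :=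
    ((ENNReal.toReal_eq_zero_iff _).1 hw).resolve_right u.2.2.ne
  refine (Submodule.Quotient.mk_eq_zero _).2 ?_
  exact mem_aeConst_of_gagliardo_eq_zero hs0 hs1 hp hsp (memLpLoc_of_mem_preW u) h

/-- The extension by continuity stays isometric, by density. -/
theorem exists_linearIsometryEquiv (hn : 0 < n) (hs0 : 0 < s) (hs1 : s ≤ 1) (hp1 : 1 < p)
    (hsp : s * p = n) :
    ∃ J : DSpace n s p hp ≃ₗᵢ[ℝ] WDot n s p hp,
      ∀ φ : TestW n s p hp, J (φ : DSpace n s p hp) = TestW.toWDot hs0 hs1 hsp φ := by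
  have : CompleteSpace (WDot n s p hp) := completeSpace_WDot hs0 hs1 hp hsp
  -- `WDot` carries only a seminormed structure; definiteness makes it separated, so that limits are
  -- unique and the extension takes the right values on test functions.
  have : T0Space (WDot n s p hp) := ⟨fun x y h => by
    rw [Metric.inseparable_iff, dist_eq_norm] at h
    exact sub_eq_zero.1 (WDot.eq_zero_of_norm_eq_zero hs0 hs1 hsp _ h)⟩
  let ι : TestW n s p hp →L[ℝ] DSpace n s p hp := UniformSpace.Completion.toComplL
  have hι : DenseRange ι := UniformSpace.Completion.denseRange_coe
  let f := (TestW.toWDot (hp := hp) hs0 hs1 hsp).toContinuousLinearMap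
  let F : DSpace n s p hp →L[ℝ] WDot n s p hp := f.extend ι
  have hF : ∀ φ : TestW n s p hp, F (φ : DSpace n s p hp) = TestW.toWDot hs0 hs1 hsp φ := fun φ =>
    f.extend_eq hι (UniformSpace.Completion.isUniformInducing_coe _) φ
  have hnorm : ∀ x, ‖F x‖ = ‖x‖ := by
    intro x
    induction x using UniformSpace.Completion.induction_on with
    | hp => exact isClosed_eq (by fun_prop) (by fun_prop)
    | ih φ => rw [hF, LinearIsometry.norm_map, UniformSpace.Completion.norm_coe]
  let Fi : DSpace n s p hp →ₗᵢ[ℝ] WDot n s p hp := ⟨F.toLinearMap, hnorm⟩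
  -- An isometric image of a complete space is closed, and this one contains a dense set.
  have hsurj : Function.Surjective Fi := by
    rw [← Set.range_eq_univ, ← Fi.isometry.isUniformInducing.isComplete_range.isClosed.closure_eq]
    refine (Dense.mono ?_ (denseRange_toWDot hn hs0 hs1 hp1 hsp)).closure_eq
    rintro _ ⟨φ, rfl⟩
    exact ⟨φ, hF φ⟩
  exact ⟨LinearIsometryEquiv.ofSurjective Fi hsurj, hF⟩

end isomorphism
end HomSobolev

end

open HomSobolev in
theorem theorem5p3 (n : ℕ) (s : ℝ) (hs0 : 0 < s) (hs1 : s ≤ 1) (hsn : s < n) :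
    (∀ w : WDot n s (n / s) (one_le_exponent hs0 hsn), ‖w‖ = 0 → w = 0) ∧
    CompleteSpace (WDot n s (n / s) (one_le_exponent hs0 hsn)) ∧
    ∃ J : DSpace n s (n / s) (one_le_exponent hs0 hsn) ≃ₗᵢ[ℝ]
        WDot n s (n / s) (one_le_exponent hs0 hsn),
      ∀ φ : TestW n s (n / s) (one_le_exponent hs0 hsn),
        ∃ h : φ.toFun ∈ preW n s (n / s) (one_le_exponent hs0 hsn),
          J (φ : DSpace n s (n / s) (one_le_exponent hs0 hsn)) = WDot.mk ⟨φ.toFun, h⟩ := by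
  have hsp : s * (n / s) = n := mul_div_cancel₀ _ hs0.ne'
  have hn : 0 < n := by
    have : (0 : ℝ) < n := hs0.trans hsn
    exact_mod_cast this
  -- The strict inequality `s < n` enters as `p > 1`, which the averaging of dilated bumps requires.
  obtain ⟨J, hJ⟩ := exists_linearIsometryEquiv (hp := one_le_exponent hs0 hsn) hn hs0 hs1
    ((one_lt_div hs0).2 hsn) hsp
  exact ⟨WDot.eq_zero_of_norm_eq_zero hs0 hs1 hsp, completeSpace_WDot hs0 hs1 _ hsp, J,
    fun φ => ⟨φ.mem_preW hs0 hs1 hsp, hJ φ⟩⟩
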